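/- Let $(\mathcal V,\otimes,I,\sigma)$ be a braided monoidal category with equalizers and coequalizers, such that the tensor product preserves coequalizers in each variable. For an algebra $A$ in $\mathcal V$ let $\mathcal V_A$ be the category of right $A$-modules. Let $H=(H,e_H,m_H,\varepsilon_H,\delta_H)$ be a bialgebra in $\mathcal V$, and let $A=(A,e_A,m_A)$ be an algebra in $\mathcal V$ with a right $H$-comodule structure $\alpha_A:A\to A\otimes H$ that is a morphism of algebras, where $A\otimes H$ has the multiplication $(m_A\otimes m_H)(A\otimes\sigma_{H,A}\otimes H)$ and the unit $e_A\otimes e_H$ (that is, $A$ is a right $H$-comodule algebra). (Associativity and unit isomorphisms of $\mathcal V$ are suppressed in the formulas.) Let $i_A:A^H\to A$ be the equalizer of $\alpha_A,\ A\otimes e_H:A\rightrightarrows A\otimes H$, with the unique algebra structure on $A^H$ for which $i_A$ is a morphism of algebras. For $X\in\mathcal V_{A^H}$ let $X\otimes_{A^H}A$ be the coequalizer of the two morphisms $X\otimes A^H\otimes A\rightrightarrows X\otimes A$ given by the action of $A^H$ on $X$ and by $m_A(i_A\otimes A)$. Let $$\lambda_{(A,\alpha_A)}=(A\otimes m_H)(\sigma_{H,A}\otimes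 H)(H\otimes\alpha_A):H\otimes A\to A\otimes H$$ be the entwining structure determined by the comodule algebra $A$. Let $\mathcal V^H_A(\lambda_{(A,\alpha_A)})$ be the category whose objects are triples $(M,\xi,\nu)$, where $(M,\xi:M\otimes A\to M)$ is a right $A$-module and $(M,\nu:M\to M\otimes H)$ is a right $H$-comodule, such that $$\nu\,\xi=(\xi\otimes H)(M\otimes\lambda_{(A,\alpha_A)})(\nu\otimes A),$$ and whose morphisms are the morphisms in $\mathcal V$ that are compatible with both structures. Then the functor $$\bar F:\mathcal V_{A^H}\to\mathcal V^H_A(\lambda_{(A,\alpha_A)}),\qquad X\mapsto(X\otimes_{A^H}A,\ X\otimes_{A^H}m_A,\ X\otimes_{A^H}\alpha_A),$$ is an equivalence of categories if and only if both of the following hold: 1. the extension-of-scalars functor $F_{i_A}:\mathcal V_{A^H}\to\mathcal V_A$, $X\mapsto(X\otimes_{A^H}A,\ X\otimes_{A^H}m_A)$, is comonadic, i.e. it has a right adjoint and the comparison functor from $\mathcal V_{A^H}$ to the category of coalgebras over the induced comonad on $\mathcal V_A$ is an equivalence; 2. the canonical morphism $\mathrm{can}:A\otimes_{A^H}A\to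 A\otimes H$ induced by $(m_A\otimes H)(A\otimes\alpha_A):A\otimes A\to A\otimes H$ is an isomorphism. -/

import Mathlib

open CategoryTheory MonoidalCategory Limits MonObj ComonObj

universe v u

namespace BraidedGalois

/-! ### Right modules and extension of scalars -/

section Modules

variable {V : Type u} [Category.{v} V] [MonoidalCategory V]

/-- A right module over the algebra `A`. -/
structure RMod (A : V) [MonObj A] where
  X : V
  act : X ⊗ A ⟶ X
  act_one : X ◁ η[A] ≫ act = (ρ_ X).hom
  act_mul : X ◁ μ[A] ≫ act = (α_ X A A).inv ≫ act ▷ A ≫ act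

namespace RMod

variable {A : V} [MonObj A]

/-- Morphisms of right modules. -/
@[ext]
structure Hom (M N : RMod A) where
  hom : M.X ⟶ N.X
  act_hom : M.act ≫ hom = hom ▷ A ≫ N.act

instance : Category (RMod A) where
  Hom M N := Hom M N
  id M := ⟨𝟙 M.X, by simp⟩
  comp f g := ⟨f.hom ≫ g.hom, by
    rw [← Category.assoc, f.act_hom, Category.assoc, g.act_hom, comp_whiskerRight,
      Category.assoc]⟩

@[ext]
theorem hom_ext {M N : RMod A} (f g : M ⟶ N) (h : f.hom = g.hom) : f = g :=
  Hom.ext h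

@[simp]
theorem id_hom (M : RMod A) : Hom.hom (𝟙 M) = 𝟙 M.X := rfl

@[simp]
theorem comp_hom {M N K : RMod A} (f : M ⟶ N) (g : N ⟶ K) :
    Hom.hom (f ≫ g) = f.hom ≫ g.hom := rfl

end RMod

/-- The algebra `A` as a right `B`-module along the algebra morphism `i : B ⟶ A`. -/
def RMod.ofHom {B A : V} [MonObj B] [MonObj A] (i : B ⟶ A) [IsMonHom i] : RMod B where
  X := A
  act := A ◁ i ≫ μ[A]
  act_one := by
    rw [← whiskerLeft_comp_assoc, IsMonHom.one_hom, MonObj.mul_one]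
  act_mul := by
    rw [← whiskerLeft_comp_assoc, IsMonHom.mul_hom, MonoidalCategory.tensorHom_def,
      MonoidalCategory.whiskerLeft_comp, MonoidalCategory.whiskerLeft_comp]
    simp only [Category.assoc]
    rw [MonObj.mul_assoc_flip, comp_whiskerRight]
    simp only [Category.assoc]
    rw [← whisker_exchange_assoc]
    simp

variable [HasCoequalizers V]

/-- For an algebra morphism `i : B ⟶ A` and a right `B`-module `X`, the object `X ⊗_B A`:
the coequalizer of the right action of `B` on `X` and the left action of `B` on `A` along `i`. -/
noncomputable def relTensor {B A : V} [MonObj B] [MonObj A] (i : B ⟶ A) (X : RMod B) : V :=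
  coequalizer (X.act ▷ A) ((α_ X.X B A).hom ≫ X.X ◁ (i ▷ A ≫ μ[A]))

/-- The canonical morphism `X ⊗ A ⟶ X ⊗_B A`. -/
noncomputable def relTensorπ {B A : V} [MonObj B] [MonObj A] (i : B ⟶ A) (X : RMod B) :
    X.X ⊗ A ⟶ relTensor i X :=
  coequalizer.π _ _

section

variable {B A : V} [MonObj B] [MonObj A] (i : B ⟶ A) (X : RMod B)

theorem relTensor_condition :
    X.act ▷ A ≫ relTensorπ i X =
      (α_ X.X B A).hom ≫ X.X ◁ (i ▷ A ≫ μ[A]) ≫ relTensorπ i X := by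
  have := coequalizer.condition (X.act ▷ A) ((α_ X.X B A).hom ≫ X.X ◁ (i ▷ A ≫ μ[A]))
  rw [Category.assoc] at this
  exact this

/-- The universal property of `X ⊗_B A`. -/
noncomputable def relTensorDesc {W : V} (h : X.X ⊗ A ⟶ W)
    (w : X.act ▷ A ≫ h = (α_ X.X B A).hom ≫ X.X ◁ (i ▷ A ≫ μ[A]) ≫ h) :
    relTensor i X ⟶ W :=
  coequalizer.desc h (by simpa only [Category.assoc] using w)

@[simp]
theorem relTensorπ_desc {W : V} (h : X.X ⊗ A ⟶ W)
    (w : X.act ▷ A ≫ h = (α_ X.X B A).hom ≫ X.X ◁ (i ▷ A ≫ μ[A]) ≫ h) :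
    relTensorπ i X ≫ relTensorDesc i X h w = h :=
  coequalizer.π_desc _ _

@[simp]
theorem relTensorπ_desc_assoc {W Z : V} (h : X.X ⊗ A ⟶ W)
    (w : X.act ▷ A ≫ h = (α_ X.X B A).hom ≫ X.X ◁ (i ▷ A ≫ μ[A]) ≫ h) (k : W ⟶ Z) :
    relTensorπ i X ≫ relTensorDesc i X h w ≫ k = h ≫ k := by
  rw [← Category.assoc, relTensorπ_desc]

instance : Epi (relTensorπ i X) :=
  inferInstanceAs (Epi (coequalizer.π (X.act ▷ A) ((α_ X.X B A).hom ≫ X.X ◁ (i ▷ A ≫ μ[A]))))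

section Map

variable {i X} {Y Z : RMod B}

variable (i) in
/-- The morphism `f ⊗_B A : X ⊗_B A ⟶ Y ⊗_B A`. -/
noncomputable def relTensorMap (f : X ⟶ Y) : relTensor i X ⟶ relTensor i Y :=
  relTensorDesc i X (f.hom ▷ A ≫ relTensorπ i Y) (by
    rw [← comp_whiskerRight_assoc, f.act_hom, comp_whiskerRight, Category.assoc,
      relTensor_condition, associator_naturality_left_assoc, whisker_exchange_assoc])

theorem relTensorπ_map (f : X ⟶ Y) :
    relTensorπ i X ≫ relTensorMap i f = f.hom ▷ A ≫ relTensorπ i Y :=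
  relTensorπ_desc ..

theorem relTensorπ_map_assoc (f : X ⟶ Y) {W : V} (k : relTensor i Y ⟶ W) :
    relTensorπ i X ≫ relTensorMap i f ≫ k = f.hom ▷ A ≫ relTensorπ i Y ≫ k := by
  rw [← Category.assoc, relTensorπ_map, Category.assoc]

theorem relTensorMap_id : relTensorMap i (𝟙 X) = 𝟙 (relTensor i X) := by
  rw [← cancel_epi (relTensorπ i X), relTensorπ_map, RMod.id_hom, id_whiskerRight,
    Category.id_comp, Category.comp_id]

theorem relTensorMap_comp (f : X ⟶ Y) (g : Y ⟶ Z) :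
    relTensorMap i (f ≫ g) = relTensorMap i f ≫ relTensorMap i g := by
  rw [← cancel_epi (relTensorπ i X), relTensorπ_map, relTensorπ_map_assoc, relTensorπ_map,
    RMod.comp_hom, comp_whiskerRight, Category.assoc]

end Map

theorem relTensorAct_aux :
    X.act ▷ A ▷ A ≫ (α_ X.X A A).hom ≫ X.X ◁ μ[A] ≫ relTensorπ i X =
      ((α_ X.X B A).hom ≫ X.X ◁ (i ▷ A ≫ μ[A])) ▷ A ≫
        (α_ X.X A A).hom ≫ X.X ◁ μ[A] ≫ relTensorπ i X := by
  have e : (α_ B A A).hom ≫ B ◁ μ[A] ≫ i ▷ A ≫ μ[A] = (i ▷ A ≫ μ[A]) ▷ A ≫ μ[A] := by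
    rw [whisker_exchange_assoc, MonObj.mul_assoc_flip]
    simp
  calc _ = (α_ (X.X ⊗ B) A A).hom ≫ (X.X ⊗ B) ◁ μ[A] ≫ X.act ▷ A ≫ relTensorπ i X := by
        rw [associator_naturality_left_assoc, ← whisker_exchange_assoc]
    _ = (α_ _ _ _).hom ▷ A ≫ (α_ _ _ _).hom ≫
          X.X ◁ ((α_ B A A).hom ≫ B ◁ μ[A] ≫ i ▷ A ≫ μ[A]) ≫ relTensorπ i X := by
        rw [relTensor_condition]; monoidal
    _ = _ := by rw [e]; monoidal

variable [∀ Z : V, PreservesColimitsOfShape WalkingParallelPair (tensorRight Z)]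

instance (Z : V) : Epi (relTensorπ i X ▷ Z) :=
  (inferInstance : Epi ((tensorRight Z).map
    (coequalizer.π (X.act ▷ A) ((α_ X.X B A).hom ≫ X.X ◁ (i ▷ A ≫ μ[A])))))

/-- The universal property of `(X ⊗_B A) ⊗ Z`, the functor `- ⊗ Z` preserving coequalizers. -/
noncomputable def relTensorDescRight (Z : V) {W : V} (h : (X.X ⊗ A) ⊗ Z ⟶ W)
    (w : X.act ▷ A ▷ Z ≫ h = ((α_ X.X B A).hom ≫ X.X ◁ (i ▷ A ≫ μ[A])) ▷ Z ≫ h) :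
    relTensor i X ⊗ Z ⟶ W :=
  (PreservesCoequalizer.iso (tensorRight Z) (X.act ▷ A)
    ((α_ X.X B A).hom ≫ X.X ◁ (i ▷ A ≫ μ[A]))).inv ≫ coequalizer.desc h w

@[simp]
theorem relTensorπ_descRight (Z : V) {W : V} (h : (X.X ⊗ A) ⊗ Z ⟶ W)
    (w : X.act ▷ A ▷ Z ≫ h = ((α_ X.X B A).hom ≫ X.X ◁ (i ▷ A ≫ μ[A])) ▷ Z ≫ h) :
    relTensorπ i X ▷ Z ≫ relTensorDescRight i X Z h w = h :=
  map_π_preserves_coequalizer_inv_desc (tensorRight Z) _ _ h w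

/-- The right action `X ⊗_B μ` of `A` on `X ⊗_B A`. -/
noncomputable def relTensorAct : relTensor i X ⊗ A ⟶ relTensor i X :=
  relTensorDescRight i X A ((α_ X.X A A).hom ≫ X.X ◁ μ[A] ≫ relTensorπ i X)
    (relTensorAct_aux i X)

theorem relTensorπ_act : relTensorπ i X ▷ A ≫ relTensorAct i X =
    (α_ X.X A A).hom ≫ X.X ◁ μ[A] ≫ relTensorπ i X :=
  relTensorπ_descRight ..

theorem relTensorπ_act_assoc {Z : V} (k : relTensor i X ⟶ Z) :
    relTensorπ i X ▷ A ≫ relTensorAct i X ≫ k =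
      (α_ X.X A A).hom ≫ X.X ◁ μ[A] ≫ relTensorπ i X ≫ k := by
  rw [← Category.assoc, relTensorπ_act, Category.assoc, Category.assoc]

theorem relTensorAct_one :
    relTensor i X ◁ η[A] ≫ relTensorAct i X = (ρ_ (relTensor i X)).hom := by
  rw [← cancel_epi (relTensorπ i X ▷ 𝟙_ V), ← whisker_exchange_assoc, relTensorπ_act,
    associator_naturality_right_assoc, ← whiskerLeft_comp_assoc, MonObj.mul_one]
  monoidal

theorem relTensorAct_mul :
    relTensor i X ◁ μ[A] ≫ relTensorAct i X =
      (α_ (relTensor i X) A A).inv ≫ relTensorAct i X ▷ A ≫ relTensorAct i X := by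
  rw [← cancel_epi (relTensorπ i X ▷ (A ⊗ A)), ← whisker_exchange_assoc, relTensorπ_act,
    associator_inv_naturality_left_assoc, ← comp_whiskerRight_assoc, relTensorπ_act]
  simp only [comp_whiskerRight, Category.assoc]
  rw [relTensorπ_act]
  have e := MonObj.mul_assoc_flip A
  calc _ = (α_ _ _ _).hom ≫ X.X ◁ (A ◁ μ[A] ≫ μ[A]) ≫ relTensorπ i X := by monoidal
    _ = _ := by rw [e]; monoidal

variable {X} in
theorem relTensorMap_act {Y : RMod B} (f : X ⟶ Y) :
    relTensorAct i X ≫ relTensorMap i f = relTensorMap i f ▷ A ≫ relTensorAct i Y := by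
  rw [← cancel_epi (relTensorπ i X ▷ A), relTensorπ_act_assoc, relTensorπ_map,
    ← comp_whiskerRight_assoc, relTensorπ_map, comp_whiskerRight, Category.assoc,
    relTensorπ_act, whisker_exchange_assoc, associator_naturality_left_assoc]

/-- The functor `X ↦ X ⊗_B A` from right `B`-modules to right `A`-modules, for an algebra
morphism `i : B ⟶ A`. -/
noncomputable def extScalars : RMod B ⥤ RMod A where
  obj X :=
    { X := relTensor i X
      act := relTensorAct i X
      act_one := relTensorAct_one i X
      act_mul := relTensorAct_mul i X }
  map f :=
    { hom := relTensorMap i f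
      act_hom := relTensorMap_act _ f }
  map_id _ := RMod.hom_ext _ _ relTensorMap_id
  map_comp f g := RMod.hom_ext _ _ (relTensorMap_comp f g)

end

end Modules

/-! ### Entwining structures and entwined modules -/

section Entwining

variable {V : Type u} [Category.{v} V] [MonoidalCategory V]

/-- An entwining structure: a morphism `C ⊗ A ⟶ A ⊗ C` between an algebra `A` and a coalgebra
`C` such that `- ⊗ hom` is a mixed distributive law from the monad `- ⊗ A` to the
comonad `- ⊗ C`. -/
structure Entwining (A C : V) [MonObj A] [ComonObj C] where
  hom : C ⊗ A ⟶ A ⊗ C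
  one_hom : C ◁ η[A] ≫ hom = (ρ_ C).hom ≫ (λ_ C).inv ≫ η[A] ▷ C
  hom_counit : hom ≫ A ◁ ε[C] = ε[C] ▷ A ≫ (λ_ A).hom ≫ (ρ_ A).inv
  hom_comul : hom ≫ A ◁ Δ[C] =
    Δ[C] ▷ A ≫ (α_ C C A).hom ≫ C ◁ hom ≫ (α_ C A C).inv ≫ hom ▷ C ≫ (α_ A C C).hom
  mul_hom : C ◁ μ[A] ≫ hom =
    (α_ C A A).inv ≫ hom ▷ A ≫ (α_ A C A).hom ≫ A ◁ hom ≫ (α_ A A C).inv ≫ μ[A] ▷ C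

/-- An object of the category of entwined modules: an object with a right action of `A` and a
right coaction of `C` which are compatible through the entwining structure. -/
structure EntwinedMod {A C : V} [MonObj A] [ComonObj C] (ψ : Entwining A C) extends RMod A where
  coact : X ⟶ X ⊗ C
  coact_counit : coact ≫ X ◁ ε[C] = (ρ_ X).inv
  coact_comul : coact ≫ X ◁ Δ[C] = coact ≫ coact ▷ C ≫ (α_ X C C).hom
  compat : act ≫ coact =
    coact ▷ A ≫ (α_ X C A).hom ≫ X ◁ ψ.hom ≫ (α_ X A C).inv ≫ act ▷ C

namespace EntwinedMod

variable {A C : V} [MonObj A] [ComonObj C] {ψ : Entwining A C}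

/-- Morphisms of entwined modules: morphisms compatible with the action and the coaction. -/
@[ext]
structure Hom (M N : EntwinedMod ψ) where
  hom : M.X ⟶ N.X
  act_hom : M.act ≫ hom = hom ▷ A ≫ N.act
  coact_hom : M.coact ≫ hom ▷ C = hom ≫ N.coact

instance : Category (EntwinedMod ψ) where
  Hom M N := Hom M N
  id M := ⟨𝟙 M.X, by simp, by simp⟩
  comp f g := ⟨f.hom ≫ g.hom, by
    rw [← Category.assoc, f.act_hom, Category.assoc, g.act_hom, comp_whiskerRight,
      Category.assoc], by
    rw [comp_whiskerRight, ← Category.assoc, f.coact_hom, Category.assoc, g.coact_hom,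
      Category.assoc]⟩

@[ext]
theorem hom_ext {M N : EntwinedMod ψ} (f g : M ⟶ N) (h : f.hom = g.hom) : f = g :=
  Hom.ext h

@[simp]
theorem id_hom (M : EntwinedMod ψ) : Hom.hom (𝟙 M) = 𝟙 M.X := rfl

@[simp]
theorem comp_hom {M N K : EntwinedMod ψ} (f : M ⟶ N) (g : N ⟶ K) :
    Hom.hom (f ≫ g) = f.hom ≫ g.hom := rfl

end EntwinedMod

end Entwining

/-! ### Comodule algebras -/

section ComodAlg

variable {V : Type u} [Category.{v} V] [MonoidalCategory V] [BraidedCategory V]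

/-- A right `H`-comodule algebra structure on the algebra `A`: a right coaction of `H` on `A`
which is a morphism of algebras to the braided tensor product algebra `A ⊗ H`. -/
class ComodAlg (H A : V) [BimonObj H] [MonObj A] where
  coact : A ⟶ A ⊗ H
  coact_counit : coact ≫ A ◁ ε[H] = (ρ_ A).inv
  coact_comul : coact ≫ A ◁ Δ[H] = coact ≫ coact ▷ H ≫ (α_ A H H).hom
  isMonHom_coact : IsMonHom coact

attribute [instance] ComodAlg.isMonHom_coact

variable (H A : V) [BimonObj H] [MonObj A]

/-- The algebra morphism `A ⊗ e_H : A ⟶ A ⊗ H`. -/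
abbrev unitIncl : A ⟶ A ⊗ H := (ρ_ A).inv ≫ A ◁ η[H]

theorem isMonHom_unitIncl : IsMonHom (unitIncl H A) := by
  have : IsMonHom η[H] := ⟨by simp, by simp [unitors_equal]⟩
  infer_instance

variable [ComodAlg H A]

/-- The coaction of a comodule algebra. -/
abbrev coact : A ⟶ A ⊗ H := ComodAlg.coact

/-- The entwining morphism of a comodule algebra: the diagonal coaction of `H` on `H ⊗ A`
(which uses the braiding and the multiplication of `H`) followed by the counit of the first factor,
that is, `(A ⊗ m_H) (σ_{H,A} ⊗ H) (H ⊗ α_A)`. -/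
def entwiningHom : H ⊗ A ⟶ A ⊗ H :=
  H ◁ coact H A ≫ (α_ H A H).inv ≫ (β_ H A).hom ▷ H ≫ (α_ A H H).hom ≫ A ◁ μ[H]

theorem compat_self : μ[A] ≫ coact H A =
    coact H A ▷ A ≫ (α_ A H A).hom ≫ A ◁ entwiningHom H A ≫ (α_ A A H).inv ≫ μ[A] ▷ H := by
  rw [IsMonHom.mul_hom, MonObj.tensorObj.mul_def, MonoidalCategory.tensorHom_def (coact H A),
    MonoidalCategory.tensorHom_def' μ[A]]
  simp only [tensorμ, entwiningHom]
  monoidal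

theorem one_entwining : η[H] ▷ A ≫ entwiningHom H A = (λ_ A).hom ≫ coact H A := by
  have e := BraidedCategory.braiding_naturality_left η[H] A
  calc _ = η[H] ▷ A ≫ H ◁ coact H A ≫ (α_ H A H).inv ≫ (β_ H A).hom ▷ H ≫
          (α_ A H H).hom ≫ A ◁ μ[H] := rfl
    _ = 𝟙_ V ◁ coact H A ≫ (α_ _ A H).inv ≫ (η[H] ▷ A ≫ (β_ H A).hom) ▷ H ≫
          (α_ A H H).hom ≫ A ◁ μ[H] := by
        rw [← whisker_exchange_assoc]; monoidal
    _ = 𝟙_ V ◁ coact H A ≫ (α_ _ A H).inv ≫ (β_ (𝟙_ V) A).hom ▷ H ≫ (α_ _ _ _).hom ≫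
          A ◁ (η[H] ▷ H ≫ μ[H]) := by
        rw [e]; monoidal
    _ = _ := by
        rw [MonObj.one_mul, braiding_tensorUnit_left]; monoidal

theorem mul_entwining : μ[H] ▷ A ≫ entwiningHom H A =
    (α_ H H A).hom ≫ H ◁ entwiningHom H A ≫ (α_ H A H).inv ≫ (β_ H A).hom ▷ H ≫
      (α_ A H H).hom ≫ A ◁ μ[H] := by
  have e := BraidedCategory.braiding_naturality_left μ[H] A
  have e2 := MonObj.mul_assoc H
  have e3 := whisker_exchange (β_ H A).hom μ[H]
  calc _ = μ[H] ▷ A ≫ H ◁ coact H A ≫ (α_ H A H).inv ≫ (β_ H A).hom ▷ H ≫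
          (α_ A H H).hom ≫ A ◁ μ[H] := rfl
    _ = (H ⊗ H) ◁ coact H A ≫ (α_ _ A H).inv ≫ (μ[H] ▷ A ≫ (β_ H A).hom) ▷ H ≫
          (α_ A H H).hom ≫ A ◁ μ[H] := by
        rw [← whisker_exchange_assoc]; monoidal
    _ = (H ⊗ H) ◁ coact H A ≫ (α_ _ A H).inv ≫ (β_ (H ⊗ H) A).hom ▷ H ≫ (α_ _ _ _).hom ≫
          A ◁ (μ[H] ▷ H ≫ μ[H]) := by
        rw [e]; monoidal
    _ = (H ⊗ H) ◁ coact H A ⊗≫ H ◁ (β_ H A).hom ▷ H ⊗≫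
          ((β_ H A).hom ▷ (H ⊗ H) ≫ (A ⊗ H) ◁ μ[H]) ⊗≫ A ◁ μ[H] := by
        rw [e2, BraidedCategory.braiding_tensor_left_hom]; monoidal
    _ = _ := by rw [← e3]; simp only [entwiningHom]; monoidal

theorem entwining_one : H ◁ η[A] ≫ entwiningHom H A = (ρ_ H).hom ≫ (λ_ H).inv ≫ η[A] ▷ H := by
  have e := BraidedCategory.braiding_naturality_right H η[A]
  have e1 : η[A] ≫ coact H A = (λ_ (𝟙_ V)).inv ≫ (η[A] ⊗ₘ η[H]) := IsMonHom.one_hom _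
  have e2 := MonObj.mul_one H
  calc _ = H ◁ (η[A] ≫ coact H A) ≫ (α_ H A H).inv ≫ (β_ H A).hom ▷ H ≫
          (α_ A H H).hom ≫ A ◁ μ[H] := by simp only [entwiningHom]; monoidal
    _ = H ◁ ((λ_ (𝟙_ V)).inv ≫ 𝟙_ V ◁ η[H]) ⊗≫ (H ◁ η[A] ≫ (β_ H A).hom) ▷ H ⊗≫
          A ◁ μ[H] := by
        rw [e1, MonoidalCategory.tensorHom_def']; monoidal
    _ = H ◁ ((λ_ (𝟙_ V)).inv ≫ 𝟙_ V ◁ η[H]) ⊗≫ (β_ H (𝟙_ V)).hom ▷ H ⊗≫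
          (η[A] ▷ (H ⊗ H) ≫ A ◁ μ[H]) := by
        rw [e]; monoidal
    _ = 𝟙 _ ⊗≫ (H ◁ η[H] ≫ μ[H]) ⊗≫ η[A] ▷ H := by
        rw [← whisker_exchange, braiding_tensorUnit_right]; monoidal
    _ = _ := by rw [e2]; monoidal

theorem entwining_counit : entwiningHom H A ≫ A ◁ ε[H] =
    ε[H] ▷ A ≫ (λ_ A).hom ≫ (ρ_ A).inv := by
  have e : μ[H] ≫ ε[H] = (ε[H] ⊗ₘ ε[H]) ≫ (λ_ (𝟙_ V)).hom := BimonObj.mul_counit H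
  have e1 := BraidedCategory.braiding_naturality_left ε[H] A
  have e2 : coact H A ≫ A ◁ ε[H] = _ := ComodAlg.coact_counit
  calc _ = H ◁ coact H A ≫ (α_ H A H).inv ≫ (β_ H A).hom ▷ H ≫ (α_ A H H).hom ≫
          A ◁ (μ[H] ≫ ε[H]) := by simp only [entwiningHom]; monoidal
    _ = H ◁ coact H A ⊗≫ ((β_ H A).hom ≫ A ◁ ε[H]) ▷ H ⊗≫ A ◁ ε[H] ⊗≫ 𝟙 _ := by
        rw [e, MonoidalCategory.tensorHom_def]; monoidal
    _ = H ◁ coact H A ⊗≫ (ε[H] ▷ (A ⊗ H) ≫ 𝟙_ V ◁ (A ◁ ε[H])) ⊗≫ 𝟙 _ := by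
        rw [← e1, braiding_tensorUnit_left]; monoidal
    _ = H ◁ (coact H A ≫ A ◁ ε[H]) ⊗≫ ε[H] ▷ A ⊗≫ 𝟙 _ := by
        rw [← whisker_exchange]; monoidal
    _ = _ := by rw [e2]; monoidal

theorem entwining_mul : H ◁ μ[A] ≫ entwiningHom H A =
    (α_ H A A).inv ≫ entwiningHom H A ▷ A ≫ (α_ A H A).hom ≫ A ◁ entwiningHom H A ≫
      (α_ A A H).inv ≫ μ[A] ▷ H := by
  have e1 := compat_self H A
  have e2 := BraidedCategory.braiding_naturality_right H μ[A]
  have e3 := mul_entwining H A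
  calc _ = H ◁ (μ[A] ≫ coact H A) ≫ (α_ H A H).inv ≫ (β_ H A).hom ▷ H ≫ (α_ A H H).hom ≫
          A ◁ μ[H] := by simp only [entwiningHom]; monoidal
    _ = H ◁ coact H A ▷ A ⊗≫ H ◁ A ◁ entwiningHom H A ⊗≫ (H ◁ μ[A] ≫ (β_ H A).hom) ▷ H ⊗≫
          A ◁ μ[H] := by
        rw [e1]; monoidal
    _ = H ◁ coact H A ▷ A ⊗≫ ((H ⊗ A) ◁ entwiningHom H A ≫ (β_ H A).hom ▷ (A ⊗ H)) ⊗≫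
          A ◁ (β_ H A).hom ▷ H ⊗≫ (μ[A] ▷ (H ⊗ H) ≫ A ◁ μ[H]) := by
        rw [e2, BraidedCategory.braiding_tensor_right_hom]; monoidal
    _ = H ◁ coact H A ▷ A ⊗≫ (β_ H A).hom ▷ (H ⊗ A) ⊗≫
          A ◁ ((α_ H H A).hom ≫ H ◁ entwiningHom H A ≫ (α_ H A H).inv ≫ (β_ H A).hom ▷ H ≫
          (α_ A H H).hom ≫ A ◁ μ[H]) ⊗≫ μ[A] ▷ H := by
        rw [whisker_exchange, ← whisker_exchange μ[A]]; monoidal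
    _ = _ := by
        rw [← e3]; simp only [entwiningHom]; monoidal

theorem entwining_comul : entwiningHom H A ≫ A ◁ Δ[H] =
    Δ[H] ▷ A ≫ (α_ H H A).hom ≫ H ◁ entwiningHom H A ≫ (α_ H A H).inv ≫
      entwiningHom H A ▷ H ≫ (α_ A H H).hom := by
  have e := BimonObj.mul_comul H
  have e1 := BraidedCategory.braiding_naturality_left Δ[H] A
  have e2 : coact H A ≫ A ◁ Δ[H] = _ := ComodAlg.coact_comul
  have e3 := BraidedCategory.braiding_naturality_right H (coact H A)
  let x : H ⊗ (H ⊗ H) ⟶ H ⊗ H :=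
    (α_ H H H).inv ≫ (β_ H H).hom ▷ H ≫ (α_ H H H).hom ≫ H ◁ μ[H]
  calc _ = H ◁ coact H A ≫ (α_ H A H).inv ≫ (β_ H A).hom ▷ H ≫ (α_ A H H).hom ≫
          A ◁ (μ[H] ≫ Δ[H]) := by simp only [entwiningHom]; monoidal
    _ = H ◁ coact H A ⊗≫ ((β_ H A).hom ≫ A ◁ Δ[H]) ▷ H ⊗≫ A ◁ (H ⊗ H) ◁ Δ[H] ⊗≫
          A ◁ H ◁ (β_ H H).hom ▷ H ⊗≫ A ◁ (μ[H] ⊗ₘ μ[H]) := by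
        rw [e, MonoidalCategory.tensorHom_def Δ[H]]; simp only [tensorμ]; monoidal
    _ = (H ◁ coact H A ≫ Δ[H] ▷ (A ⊗ H)) ⊗≫
          ((β_ (H ⊗ H) A).hom ▷ H ≫ (A ⊗ (H ⊗ H)) ◁ Δ[H]) ⊗≫
          A ◁ H ◁ (β_ H H).hom ▷ H ⊗≫ A ◁ (μ[H] ⊗ₘ μ[H]) := by
        rw [← e1]; monoidal
    _ = Δ[H] ▷ A ⊗≫ (H ⊗ H) ◁ (coact H A ≫ A ◁ Δ[H]) ⊗≫ (β_ (H ⊗ H) A).hom ▷ (H ⊗ H) ⊗≫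
          A ◁ H ◁ (β_ H H).hom ▷ H ⊗≫ A ◁ ((H ⊗ H) ◁ μ[H] ≫ μ[H] ▷ H) := by
        rw [whisker_exchange, ← whisker_exchange (β_ (H ⊗ H) A).hom,
          MonoidalCategory.tensorHom_def']; monoidal
    _ = Δ[H] ▷ A ⊗≫ H ◁ H ◁ coact H A ⊗≫ H ◁ H ◁ coact H A ▷ H ⊗≫
          H ◁ (β_ H A).hom ▷ (H ⊗ H) ⊗≫
          ((β_ H A).hom ▷ (H ⊗ (H ⊗ H)) ≫ (A ⊗ H) ◁ x) ⊗≫ A ◁ μ[H] ▷ H := by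
        rw [e2, BraidedCategory.braiding_tensor_left_hom]; simp only [x]; monoidal
    _ = Δ[H] ▷ A ⊗≫ H ◁ H ◁ coact H A ⊗≫ H ◁ (H ◁ coact H A ≫ (β_ H (A ⊗ H)).hom) ▷ H ⊗≫
          (H ⊗ A ⊗ H) ◁ μ[H] ⊗≫ (β_ H A).hom ▷ (H ⊗ H) ⊗≫ A ◁ μ[H] ▷ H := by
        rw [← whisker_exchange (β_ H A).hom x, BraidedCategory.braiding_tensor_right_hom]
        simp only [x]; monoidal
    _ = Δ[H] ▷ A ⊗≫ H ◁ H ◁ coact H A ⊗≫ H ◁ (β_ H A).hom ▷ H ⊗≫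
          H ◁ (coact H A ▷ (H ⊗ H) ≫ (A ⊗ H) ◁ μ[H]) ⊗≫
          (β_ H A).hom ▷ (H ⊗ H) ⊗≫ A ◁ μ[H] ▷ H := by
        rw [e3]; monoidal
    _ = _ := by
        rw [← whisker_exchange (coact H A) μ[H]]; simp only [entwiningHom]; monoidal

/-- The entwining structure of a right `H`-comodule algebra. -/
def entwining : Entwining A H where
  hom := entwiningHom H A
  one_hom := entwining_one H A
  hom_counit := entwining_counit H A
  hom_comul := entwining_comul H A
  mul_hom := entwining_mul H A

end ComodAlg

/-! ### Coinvariants -/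

section Coinvariants

variable {V : Type u} [Category.{v} V] [MonoidalCategory V] [BraidedCategory V] [HasEqualizers V]
variable (H A : V) [BimonObj H] [MonObj A] [ComodAlg H A]

/-- The coinvariants of a comodule algebra: the equalizer of `α_A` and `A ⊗ e_H`. -/
noncomputable def coinv : V := equalizer (coact H A) (unitIncl H A)

/-- The inclusion of the coinvariants. -/
noncomputable def coinvIncl : coinv H A ⟶ A := equalizer.ι _ _

theorem coinv_condition :
    coinvIncl H A ≫ coact H A = coinvIncl H A ≫ unitIncl H A :=
  equalizer.condition _ _

instance : Mono (coinvIncl H A) :=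
  inferInstanceAs (Mono (equalizer.ι (coact H A) (unitIncl H A)))

/-- The unit of the algebra of coinvariants. -/
noncomputable def coinvOne : 𝟙_ V ⟶ coinv H A :=
  equalizer.lift η[A] (by
    have := isMonHom_unitIncl H A
    rw [IsMonHom.one_hom, IsMonHom.one_hom])

/-- The multiplication of the algebra of coinvariants. -/
noncomputable def coinvMul : coinv H A ⊗ coinv H A ⟶ coinv H A :=
  equalizer.lift ((coinvIncl H A ⊗ₘ coinvIncl H A) ≫ μ[A]) (by
    have := isMonHom_unitIncl H A
    rw [Category.assoc, Category.assoc, IsMonHom.mul_hom, IsMonHom.mul_hom,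
      tensorHom_comp_tensorHom_assoc, tensorHom_comp_tensorHom_assoc, coinv_condition])

theorem coinvOne_incl : coinvOne H A ≫ coinvIncl H A = η[A] := equalizer.lift_ι _ _

theorem coinvMul_incl : coinvMul H A ≫ coinvIncl H A =
    (coinvIncl H A ⊗ₘ coinvIncl H A) ≫ μ[A] := equalizer.lift_ι _ _

/-- The algebra structure on the coinvariants for which the inclusion is a morphism of algebras. -/
noncomputable instance : MonObj (coinv H A) where
  one := coinvOne H A
  mul := coinvMul H A
  one_mul := by
    rw [← cancel_mono (coinvIncl H A), Category.assoc, coinvMul_incl,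
      MonoidalCategory.tensorHom_def, Category.assoc, ← comp_whiskerRight_assoc, coinvOne_incl,
      ← whisker_exchange_assoc, MonObj.one_mul, leftUnitor_naturality]
  mul_one := by
    rw [← cancel_mono (coinvIncl H A), Category.assoc, coinvMul_incl,
      MonoidalCategory.tensorHom_def', Category.assoc, ← whiskerLeft_comp_assoc, coinvOne_incl,
      whisker_exchange_assoc, MonObj.mul_one, rightUnitor_naturality]
  mul_assoc := by
    rw [← cancel_mono (coinvIncl H A)]
    simp only [Category.assoc, coinvMul_incl]
    have e1 : coinvMul H A ▷ coinv H A ≫ (coinvIncl H A ⊗ₘ coinvIncl H A) =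
        ((coinvIncl H A ⊗ₘ coinvIncl H A) ⊗ₘ coinvIncl H A) ≫ μ[A] ▷ A := by
      rw [whiskerRight_comp_tensorHom, coinvMul_incl, tensorHom_comp_whiskerRight]
    have e2 : coinv H A ◁ coinvMul H A ≫ (coinvIncl H A ⊗ₘ coinvIncl H A) =
        (coinvIncl H A ⊗ₘ (coinvIncl H A ⊗ₘ coinvIncl H A)) ≫ A ◁ μ[A] := by
      rw [whiskerLeft_comp_tensorHom, coinvMul_incl, tensorHom_comp_whiskerLeft]
    rw [reassoc_of% e1, reassoc_of% e2, MonObj.mul_assoc, associator_naturality_assoc]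

instance : IsMonHom (coinvIncl H A) where
  one_hom := coinvOne_incl H A
  mul_hom := coinvMul_incl H A

end Coinvariants

/-! ### The Galois functor and the canonical morphism -/

section Galois

variable {V : Type u} [Category.{v} V] [MonoidalCategory V] [BraidedCategory V]
variable [HasEqualizers V]
variable (H A : V) [BimonObj H] [MonObj A] [ComodAlg H A]

theorem coinv_linear : coinvIncl H A ▷ A ≫ μ[A] ≫ coact H A =
    coinv H A ◁ coact H A ≫ (α_ (coinv H A) A H).inv ≫ (coinvIncl H A ▷ A ≫ μ[A]) ▷ H := by
  have e := one_entwining H A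
  rw [compat_self, ← comp_whiskerRight_assoc, coinv_condition]
  calc _ = coinvIncl H A ▷ A ⊗≫ A ◁ (η[H] ▷ A ≫ entwiningHom H A) ⊗≫ μ[A] ▷ H := by monoidal
    _ = (coinvIncl H A ▷ A ≫ A ◁ coact H A) ⊗≫ μ[A] ▷ H := by rw [e]; monoidal
    _ = _ := by rw [← whisker_exchange]; monoidal

variable [HasCoequalizers V]

/-- The canonical morphism `A ⊗_{A^H} A ⟶ A ⊗ H`, induced by
`A ⊗ A ⟶ A ⊗ A ⊗ H ⟶ A ⊗ H`, i.e. by `A ⊗ α_A` followed by `m_A ⊗ H`. -/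
noncomputable def can : relTensor (coinvIncl H A) (RMod.ofHom (coinvIncl H A)) ⟶ A ⊗ H :=
  relTensorDesc (coinvIncl H A) (RMod.ofHom (coinvIncl H A))
    (A ◁ coact H A ≫ (α_ A A H).inv ≫ μ[A] ▷ H) (by
      have e := coinv_linear H A
      have e1 := MonObj.mul_assoc_flip A
      change (A ◁ coinvIncl H A ≫ μ[A]) ▷ A ≫ A ◁ coact H A ≫ (α_ A A H).inv ≫ μ[A] ▷ H =
        (α_ A (coinv H A) A).hom ≫ A ◁ (coinvIncl H A ▷ A ≫ μ[A]) ≫ A ◁ coact H A ≫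
          (α_ A A H).inv ≫ μ[A] ▷ H
      symm
      calc _ = 𝟙 _ ⊗≫ A ◁ (coinvIncl H A ▷ A ≫ μ[A] ≫ coact H A) ⊗≫ μ[A] ▷ H := by monoidal
        _ = 𝟙 _ ⊗≫ (A ⊗ coinv H A) ◁ coact H A ⊗≫ A ◁ coinvIncl H A ▷ A ▷ H ⊗≫
              (A ◁ μ[A] ≫ μ[A]) ▷ H := by rw [e]; monoidal
        _ = ((A ⊗ coinv H A) ◁ coact H A ≫ (A ◁ coinvIncl H A ≫ μ[A]) ▷ (A ⊗ H)) ⊗≫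
              μ[A] ▷ H := by
            rw [e1]; monoidal
        _ = _ := by rw [whisker_exchange]; monoidal)

variable (X : RMod (coinv H A))

/-- The coaction `X ⊗_{A^H} α_A` of `H` on `X ⊗_{A^H} A`. -/
noncomputable def relTensorCoact :
    relTensor (coinvIncl H A) X ⟶ relTensor (coinvIncl H A) X ⊗ H :=
  relTensorDesc (coinvIncl H A) X
    (X.X ◁ coact H A ≫ (α_ X.X A H).inv ≫ relTensorπ (coinvIncl H A) X ▷ H) (by
      have e := coinv_linear H A
      have e1 := relTensor_condition (coinvIncl H A) X
      symm
      calc _ = 𝟙 _ ⊗≫ X.X ◁ (coinvIncl H A ▷ A ≫ μ[A] ≫ coact H A) ⊗≫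
              relTensorπ (coinvIncl H A) X ▷ H := by monoidal
        _ = 𝟙 _ ⊗≫ (X.X ⊗ coinv H A) ◁ coact H A ⊗≫ ((α_ X.X (coinv H A) A).hom ≫
              X.X ◁ (coinvIncl H A ▷ A ≫ μ[A]) ≫ relTensorπ (coinvIncl H A) X) ▷ H := by
            rw [e]; monoidal
        _ = ((X.X ⊗ coinv H A) ◁ coact H A ≫ X.act ▷ (A ⊗ H)) ⊗≫
              relTensorπ (coinvIncl H A) X ▷ H := by
            rw [← e1]; monoidal
        _ = _ := by rw [whisker_exchange]; monoidal)

theorem relTensorπ_coact : relTensorπ (coinvIncl H A) X ≫ relTensorCoact H A X =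
    X.X ◁ coact H A ≫ (α_ X.X A H).inv ≫ relTensorπ (coinvIncl H A) X ▷ H :=
  relTensorπ_desc ..

theorem relTensorπ_coact_assoc {Z : V} (k : relTensor (coinvIncl H A) X ⊗ H ⟶ Z) :
    relTensorπ (coinvIncl H A) X ≫ relTensorCoact H A X ≫ k =
      X.X ◁ coact H A ≫ (α_ X.X A H).inv ≫ relTensorπ (coinvIncl H A) X ▷ H ≫ k := by
  rw [← Category.assoc, relTensorπ_coact, Category.assoc, Category.assoc]

theorem relTensorCoact_counit : relTensorCoact H A X ≫ relTensor (coinvIncl H A) X ◁ ε[H] =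
    (ρ_ _).inv := by
  have e : coact H A ≫ A ◁ ε[H] = _ := ComodAlg.coact_counit
  rw [← cancel_epi (relTensorπ (coinvIncl H A) X), relTensorπ_coact_assoc, ← whisker_exchange]
  calc _ = X.X ◁ (coact H A ≫ A ◁ ε[H]) ⊗≫ relTensorπ (coinvIncl H A) X ⊗≫ 𝟙 _ := by monoidal
    _ = _ := by rw [e]; monoidal

theorem relTensorCoact_comul : relTensorCoact H A X ≫ relTensor (coinvIncl H A) X ◁ Δ[H] =
    relTensorCoact H A X ≫ relTensorCoact H A X ▷ H ≫ (α_ _ H H).hom := by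
  have e : coact H A ≫ A ◁ Δ[H] = coact H A ≫ coact H A ▷ H ≫ (α_ A H H).hom :=
    ComodAlg.coact_comul
  rw [← cancel_epi (relTensorπ (coinvIncl H A) X), relTensorπ_coact_assoc, ← whisker_exchange,
    relTensorπ_coact_assoc, ← comp_whiskerRight_assoc, relTensorπ_coact]
  calc _ = X.X ◁ (coact H A ≫ A ◁ Δ[H]) ⊗≫ relTensorπ (coinvIncl H A) X ▷ (H ⊗ H) := by monoidal
    _ = _ := by rw [e]; monoidal

theorem relTensorMap_coact {Y : RMod (coinv H A)} (f : X ⟶ Y) :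
    relTensorCoact H A X ≫ relTensorMap (coinvIncl H A) f ▷ H =
      relTensorMap (coinvIncl H A) f ≫ relTensorCoact H A Y := by
  rw [← cancel_epi (relTensorπ (coinvIncl H A) X), relTensorπ_coact_assoc,
    relTensorπ_map_assoc, relTensorπ_coact, ← comp_whiskerRight, relTensorπ_map,
    comp_whiskerRight, ← associator_inv_naturality_left_assoc, whisker_exchange_assoc]

variable [∀ Z : V, PreservesColimitsOfShape WalkingParallelPair (tensorRight Z)]

theorem relTensor_compat : relTensorAct (coinvIncl H A) X ≫ relTensorCoact H A X =
    relTensorCoact H A X ▷ A ≫ (α_ _ H A).hom ≫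
      relTensor (coinvIncl H A) X ◁ (entwining H A).hom ≫ (α_ _ A H).inv ≫
        relTensorAct (coinvIncl H A) X ▷ H := by
  have e := compat_self H A
  have e1 := relTensorπ_act (coinvIncl H A) X
  change _ = relTensorCoact H A X ▷ A ≫ (α_ _ H A).hom ≫
      relTensor (coinvIncl H A) X ◁ entwiningHom H A ≫ (α_ _ A H).inv ≫
        relTensorAct (coinvIncl H A) X ▷ H
  rw [← cancel_epi (relTensorπ (coinvIncl H A) X ▷ A), relTensorπ_act_assoc, relTensorπ_coact,
    ← comp_whiskerRight_assoc, relTensorπ_coact]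
  symm
  calc _ = (α_ X.X A A).hom ≫ X.X ◁ coact H A ▷ A ⊗≫
        (relTensorπ (coinvIncl H A) X ▷ (H ⊗ A) ≫
          relTensor (coinvIncl H A) X ◁ entwiningHom H A) ⊗≫
        relTensorAct (coinvIncl H A) X ▷ H := by monoidal
    _ = (α_ X.X A A).hom ≫ X.X ◁ coact H A ▷ A ⊗≫ (X.X ⊗ A) ◁ entwiningHom H A ⊗≫
        (relTensorπ (coinvIncl H A) X ▷ A ≫ relTensorAct (coinvIncl H A) X) ▷ H := by
      rw [← whisker_exchange]; monoidal
    _ = (α_ X.X A A).hom ≫ X.X ◁ (coact H A ▷ A ≫ (α_ A H A).hom ≫ A ◁ entwiningHom H A ≫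
          (α_ A A H).inv ≫ μ[A] ▷ H) ≫ (α_ X.X A H).inv ≫
            relTensorπ (coinvIncl H A) X ▷ H := by
      rw [e1]; monoidal
    _ = (α_ X.X A A).hom ≫ X.X ◁ μ[A] ≫ X.X ◁ coact H A ≫ (α_ X.X A H).inv ≫
          relTensorπ (coinvIncl H A) X ▷ H := by
      rw [← e]; monoidal

/-- The functor `X ↦ (X ⊗_{A^H} A, X ⊗_{A^H} m_A, X ⊗_{A^H} α_A)` from right modules over the
coinvariants to entwined modules. -/
noncomputable def galoisFunctor : RMod (coinv H A) ⥤ EntwinedMod (entwining H A) where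
  obj X :=
    { X := relTensor (coinvIncl H A) X
      act := relTensorAct (coinvIncl H A) X
      act_one := relTensorAct_one (coinvIncl H A) X
      act_mul := relTensorAct_mul (coinvIncl H A) X
      coact := relTensorCoact H A X
      coact_counit := relTensorCoact_counit H A X
      coact_comul := relTensorCoact_comul H A X
      compat := relTensor_compat H A X }
  map {X _} f :=
    { hom := relTensorMap (coinvIncl H A) f
      act_hom := relTensorMap_act _ f
      coact_hom := relTensorMap_coact H A X f }
  map_id _ := EntwinedMod.hom_ext _ _ relTensorMap_id
  map_comp f g := EntwinedMod.hom_ext _ _ (relTensorMap_comp f g)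

end Galois

end BraidedGalois

namespace BraidedGalois

/-! ### Functors into a comonadic category -/

section AdjointTriangle

universe u₁ u₂ u₃

variable {C : Type u₁} {D : Type u₂} {E : Type u₃} [Category.{v} C] [Category.{v} D]
  [Category.{v} E] {K : C ⥤ E} {L : E ⥤ D} {R : D ⥤ C} {R' : D ⥤ E}

/-! Forgetting the coaction turns the Galois functor `K` into extension of scalars, so `K` sits over
`V_A` in an adjoint triangle. The forgetful functor `L` from entwined modules has the right adjoint
`R' = - ⊗ H`, and entwined modules are exactly the coalgebras of the resulting comonad. The
composite `K ⋙ L` has restriction of scalars `R` as right adjoint.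

The two adjunctions give a natural morphism `t : K R M ⟶ R' M`, and `L t` compares the comonads `L K
R` and `L R'`. If `L` is comonadic, `K` is an equivalence exactly when `K ⋙ L` is comonadic and
every `t` is invertible (`isEquivalence_iff_comonadic`). In one direction, precomposing a comonadic
functor with an equivalence keeps it comonadic, and `t` is invertible by a Yoneda argument. In the
other, `C` and `E` are both categories of coalgebras, over comonads that `L t` identifies.

Here `t` is `M ⊗_{A^H} A ⟶ M ⊗ H`, `m ⊗ a ↦ m a₀ ⊗ a₁`, where `α(a) = a₀ ⊗ a₁`. For `M = A` this is
`can`. Conversely, `can` invertible makes `t` invertible for every `M`, with inverse `m ⊗ h ↦ m ·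
can⁻¹(1 ⊗ h)` (`isIso_of_isIso_regular`, `isIso_coact_counit_iff`). -/

/-- The canonical morphism `K R M ⟶ R' M` in an adjoint triangle. -/
def triangleHom (adj : K ⋙ L ⊣ R) (adj' : L ⊣ R') (M : D) : K.obj (R.obj M) ⟶ R'.obj M :=
  adj'.unit.app (K.obj (R.obj M)) ≫ R'.map (adj.counit.app M)

variable (adj : K ⋙ L ⊣ R) (adj' : L ⊣ R')

theorem triangleHom_naturality {M N : D} (f : M ⟶ N) :
    K.map (R.map f) ≫ triangleHom adj adj' N = triangleHom adj adj' M ≫ R'.map f := by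
  have e := adj.counit.naturality f
  have e' := adj'.unit.naturality (K.map (R.map f))
  simp only [triangleHom, Category.assoc, ← R'.map_comp]
  erw [← e, R'.map_comp, reassoc_of% e']
  rfl

/-- Naturality of the unit of `adj'` and a triangle identity for `adj`. Under `L`, this says that
`t` carries the `L K R`-coalgebra structure of `L K X` to its `L R'`-coalgebra structure. -/
theorem map_unit_triangleHom (X : C) :
    K.map (adj.unit.app X) ≫ triangleHom adj adj' (L.obj (K.obj X)) =
      adj'.unit.app (K.obj X) := by
  have e := adj.left_triangle_components X
  have e' := adj'.unit.naturality (K.map (adj.unit.app X))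
  dsimp only [triangleHom]
  erw [reassoc_of% e', ← R'.map_comp, e, R'.map_id, Category.comp_id]

/-- Compatibility of `L t` with the counits of the two comonads. -/
theorem map_triangleHom_counit (M : D) :
    L.map (triangleHom adj adj' M) ≫ adj'.counit.app M = adj.counit.app M := by
  have e' := adj'.counit.naturality (adj.counit.app M)
  dsimp only [triangleHom]
  rw [L.map_comp, Category.assoc]
  erw [e']
  exact adj'.left_triangle_components_assoc _ _

/-- Composing the hom-set bijections of the two adjunctions gives `C(X, R M) ≅ D(L K X, M) ≅ E(K X,
R' M)`, and this is `f ↦ K f ≫ t`. Since `K` is full and essentially surjective, `t` is then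
invertible. -/
theorem isIso_triangleHom_of_isEquivalence [K.IsEquivalence] (M : D) :
    IsIso (triangleHom adj adj' M) := by
  have key (X : C) (f : X ⟶ R.obj M) : adj'.homEquiv (K.obj X) M ((adj.homEquiv X M).symm f) =
      K.map f ≫ triangleHom adj adj' M := by
    rw [adj.homEquiv_counit, adj'.homEquiv_unit]
    have e' := adj'.unit.naturality (K.map f)
    dsimp only [triangleHom]
    erw [R'.map_comp, ← reassoc_of% e']
  have bij (X : C) : Function.Bijective
      (fun f : X ⟶ R.obj M => K.map f ≫ triangleHom adj adj' M) := by
    have := ((adj.homEquiv X M).symm.trans (adj'.homEquiv (K.obj X) M)).bijective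
    convert this using 1
    funext f
    exact (key X f).symm
  -- Surjectivity applies only to morphisms out of the image of `K`, so the identity of `R' M` is
  -- first transported there along `j`; this yields a right inverse of `t`.
  let j := K.objObjPreimageIso (R'.obj M)
  obtain ⟨s, hs⟩ := (bij _).2 j.hom
  have h1 : (j.inv ≫ K.map s) ≫ triangleHom adj adj' M = 𝟙 _ := by
    rw [Category.assoc]
    exact (congrArg (j.inv ≫ ·) hs).trans j.inv_hom_id
  refine ⟨j.inv ≫ K.map s, ?_, h1⟩
  -- The other composite is an endomorphism of `K R M`, hence some `K g`; injectivity of `f ↦ K f ≫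
  -- t` forces `g = 𝟙`.
  obtain ⟨g, hg⟩ := K.map_surjective (triangleHom adj adj' M ≫ j.inv ≫ K.map s)
  rw [← hg, ← K.map_id]
  congr 1
  apply (bij _).1
  change K.map g ≫ _ = K.map _ ≫ _
  rw [hg, Category.assoc, h1, K.map_id, Category.comp_id, Category.id_comp]

/-- Beck's criterion: `K` sends a `K ⋙ L`-cosplit pair to an `L`-cosplit pair, whose equalizer `L`
creates; the equivalence `K` creates it in turn. -/
theorem comonadicLeftAdjoint_of_isEquivalence (adj : K ⋙ L ⊣ R) (adj' : L ⊣ R') [K.IsEquivalence]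
    [(Comonad.comparison adj').IsEquivalence] :
    Nonempty (ComonadicLeftAdjoint (K ⋙ L)) := by
  let : ComonadicLeftAdjoint L := ⟨R', adj', inferInstance⟩
  have (X Y : C) (f g : X ⟶ Y) [h : (K ⋙ L).IsCosplitPair f g] :
      CreatesLimit (parallelPair f g) (K ⋙ L) := by
    have : L.IsCosplitPair (K.map f) (K.map g) := ⟨h.splittable⟩
    have : CreatesLimit (parallelPair ((parallelPair f g ⋙ K).map WalkingParallelPairHom.left)
        ((parallelPair f g ⋙ K).map WalkingParallelPairHom.right)) L :=
      Comonad.createsFSplitEqualizersOfComonadic (F := L) (K.map f) (K.map g)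
    have : CreatesLimit (parallelPair f g ⋙ K) L :=
      createsLimitOfIsoDiagram L (diagramIsoParallelPair (parallelPair f g ⋙ K)).symm
    infer_instance
  have : Comonad.CreatesLimitOfIsCosplitPair (K ⋙ L) := ⟨fun {X Y} f g _ => this X Y f g⟩
  exact ⟨Comonad.comonadicOfCreatesFSplitEqualizers adj⟩

/-- Comonadicity comes with its own choice of right adjoint; Beck's condition mentions only `F`, so
it passes to any given adjunction. -/
theorem isEquivalence_comparison {F : C ⥤ D} (adj : F ⊣ R) [ComonadicLeftAdjoint F] :
    (Comonad.comparison adj).IsEquivalence := by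
  have : Comonad.CreatesLimitOfIsCosplitPair F :=
    ⟨fun {X Y} f g _ => Comonad.createsFSplitEqualizersOfComonadic f g⟩
  exact (Comonad.comonadicOfCreatesFSplitEqualizers adj).eqv

variable {adj adj'} in
-- The hypothesis `h` says that `f` is a morphism of `L R'`-coalgebras.
theorem exists_map_eq_of_comparison_full (hL : (Comonad.comparison adj').Full) {N N' : E}
    (f : L.obj N ⟶ L.obj N')
    (h : L.map (adj'.unit.app N) ≫ L.map (R'.map f) = f ≫ L.map (adj'.unit.app N')) :
    ∃ g : N ⟶ N', L.map g = f := by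
  obtain ⟨g, hg⟩ := (Comonad.comparison adj').map_surjective (X := N) (Y := N') ⟨f, h⟩
  exact ⟨g, congrArg Comonad.Coalgebra.Hom.f hg⟩

/-- A coalgebra over the comonad of `adj` on `L N`, for an object `N` of `E`. -/
noncomputable def triangleCoalgebra [∀ M, IsIso (triangleHom adj adj' M)] (N : E) :
    adj.toComonad.Coalgebra where
  A := L.obj N
  a := L.map (adj'.unit.app N ≫ inv (triangleHom adj adj' (L.obj N)))
  counit := by
    change _ ≫ adj.counit.app (L.obj N) = _
    rw [← map_triangleHom_counit adj adj']
    rw [← L.map_comp_assoc]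
    simp
  coassoc := by
    change L.map _ ≫ L.map (K.map (adj.unit.app (R.obj (L.obj N)))) =
      L.map _ ≫ L.map (K.map (R.map (L.map _)))
    rw [← L.map_comp, ← L.map_comp]
    congr 1
    -- After composing with the invertible `t`, coassociativity becomes naturality of the unit of
    -- `adj'`.
    rw [← cancel_mono (triangleHom adj adj' (L.obj (K.obj (R.obj (L.obj N)))))]
    simp only [Category.assoc]
    rw [map_unit_triangleHom, triangleHom_naturality]
    have e := adj'.unit.naturality (adj'.unit.app N ≫ inv (triangleHom adj adj' (L.obj N)))
    simpa using e

/-- Invertibility of `t` lets coalgebra structures and their morphisms pass between `L K R` and `L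
R'`; each side is then lifted through its own comparison functor. -/
theorem isEquivalence_of_isIso_triangleHom [(Comonad.comparison adj').IsEquivalence]
    [(Comonad.comparison adj).IsEquivalence] [∀ M, IsIso (triangleHom adj adj' M)] :
    K.IsEquivalence where
  faithful := by
    have : (Comonad.comparison adj ⋙ adj.toComonad.forget).Faithful := inferInstance
    have : (K ⋙ L).Faithful := Functor.Faithful.of_iso (Comonad.comparisonForget adj)
    exact Functor.Faithful.of_comp K L
  full := ⟨fun {X Y} g => by
    have : (Comonad.comparison adj' ⋙ adj'.toComonad.forget).Faithful := inferInstance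
    have : L.Faithful := Functor.Faithful.of_iso (Comonad.comparisonForget adj')
    obtain ⟨f, hf⟩ := (Comonad.comparison adj).map_surjective (X := X) (Y := Y) ⟨L.map g, by
      change L.map (K.map (adj.unit.app X)) ≫ L.map (K.map (R.map (L.map g))) =
        L.map g ≫ L.map (K.map (adj.unit.app Y))
      rw [← L.map_comp, ← L.map_comp]
      congr 1
      rw [← cancel_mono (triangleHom adj adj' (L.obj (K.obj Y)))]
      simp only [Category.assoc]
      rw [map_unit_triangleHom, triangleHom_naturality]
      have e := map_unit_triangleHom adj adj' X
      erw [reassoc_of% e]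
      exact (adj'.unit.naturality g).symm⟩
    exact ⟨f, L.map_injective (congrArg Comonad.Coalgebra.Hom.f hf)⟩⟩
  essSurj := ⟨fun N => by
    have : (Comonad.comparison adj' ⋙ adj'.toComonad.forget).Faithful := inferInstance
    have : L.Faithful := Functor.Faithful.of_iso (Comonad.comparisonForget adj')
    let j := (Comonad.comparison adj).objObjPreimageIso (triangleCoalgebra adj adj' N)
    set X := (Comonad.comparison adj).objPreimage (triangleCoalgebra adj adj' N)
    obtain ⟨f, f', hj1, hj2, hj⟩ : ∃ (f : L.obj (K.obj X) ⟶ L.obj N) (f' : L.obj N ⟶ _),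
        f ≫ f' = 𝟙 _ ∧ f' ≫ f = 𝟙 _ ∧
        L.map (K.map (adj.unit.app X)) ≫ L.map (K.map (R.map f)) =
          f ≫ L.map (adj'.unit.app N ≫ inv (triangleHom adj adj' (L.obj N))) :=
      ⟨j.hom.f, j.inv.f, congrArg Comonad.Coalgebra.Hom.f j.hom_inv_id,
        congrArg Comonad.Coalgebra.Hom.f j.inv_hom_id, j.hom.h⟩
    -- Composing `hj` with `L t` turns the isomorphism of `L K R`-coalgebras into one of `L
    -- R'`-coalgebras, which lifts to `K X ≅ N`.
    have h1 : L.map (adj'.unit.app (K.obj X)) ≫ L.map (R'.map f) =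
        f ≫ L.map (adj'.unit.app N) := by
      have e := congrArg (· ≫ L.map (triangleHom adj adj' (L.obj N))) hj
      rw [Category.assoc, Category.assoc, ← L.map_comp, ← L.map_comp, ← L.map_comp,
        triangleHom_naturality, Category.assoc, IsIso.inv_hom_id, Category.comp_id] at e
      have e2 := map_unit_triangleHom adj adj' X
      rw [← L.map_comp, ← e2, Category.assoc]
      exact e
    have h2 : L.map (adj'.unit.app N) ≫ L.map (R'.map f') =
        f' ≫ L.map (adj'.unit.app (K.obj X)) := by
      have : L.map (adj'.unit.app N) = f' ≫ f ≫ L.map (adj'.unit.app N) := by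
        rw [reassoc_of% hj2]
      rw [this, ← h1, Category.assoc, Category.assoc, ← L.map_comp, ← R'.map_comp, hj1,
        R'.map_id]
      erw [L.map_id, Category.comp_id]
    obtain ⟨g, hg⟩ := exists_map_eq_of_comparison_full (adj' := adj') inferInstance _ h1
    obtain ⟨g', hg'⟩ := exists_map_eq_of_comparison_full (adj' := adj') inferInstance _ h2
    exact ⟨X, ⟨⟨g, g', L.map_injective (by rw [L.map_comp, hg, hg', hj1, L.map_id]),
      L.map_injective (by rw [L.map_comp, hg, hg', hj2, L.map_id])⟩⟩⟩⟩

/-- In an adjoint triangle over a comonadic functor `L`, the functor `K` is an equivalence if and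
only if `K ⋙ L` is comonadic and the canonical morphism of comonads is invertible. -/
theorem isEquivalence_iff_comonadic [(Comonad.comparison adj').IsEquivalence] :
    K.IsEquivalence ↔
      Nonempty (ComonadicLeftAdjoint (K ⋙ L)) ∧ ∀ M, IsIso (triangleHom adj adj' M) := by
  constructor
  · intro _
    exact ⟨comonadicLeftAdjoint_of_isEquivalence adj adj',
      isIso_triangleHom_of_isEquivalence adj adj'⟩
  · rintro ⟨⟨_⟩, _⟩
    have := isEquivalence_comparison adj
    exact isEquivalence_of_isIso_triangleHom adj adj'

end AdjointTriangle

/-! ### Restriction of scalars -/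

section Restriction

variable {V : Type u} [Category.{v} V] [MonoidalCategory V] {B A : V} [MonObj B] [MonObj A]

variable (A) in
/-- The regular right module. -/
def RMod.regular : RMod A where
  X := A
  act := μ[A]
  act_one := MonObj.mul_one A
  act_mul := MonObj.mul_assoc_flip A

/-- A right `A`-module as a right `B`-module along an algebra morphism `i : B ⟶ A`. -/
def RMod.restrict (i : B ⟶ A) [IsMonHom i] (M : RMod A) : RMod B where
  X := M.X
  act := M.X ◁ i ≫ M.act
  act_one := by
    rw [← whiskerLeft_comp_assoc, IsMonHom.one_hom, M.act_one]
  act_mul := by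
    rw [← whiskerLeft_comp_assoc, IsMonHom.mul_hom, MonoidalCategory.tensorHom_def,
      MonoidalCategory.whiskerLeft_comp, MonoidalCategory.whiskerLeft_comp]
    simp only [Category.assoc]
    rw [M.act_mul, comp_whiskerRight]
    simp only [Category.assoc]
    rw [← whisker_exchange_assoc]
    simp

/-- Restriction of scalars along an algebra morphism. -/
def resScalars (i : B ⟶ A) [IsMonHom i] : RMod A ⥤ RMod B where
  obj M := M.restrict i
  map {M N} f :=
    { hom := f.hom
      act_hom := by
        change (M.X ◁ i ≫ M.act) ≫ f.hom = f.hom ▷ B ≫ N.X ◁ i ≫ N.act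
        rw [Category.assoc, f.act_hom, whisker_exchange_assoc] }

variable [HasCoequalizers V] (i : B ⟶ A)

/-- The morphism `X ⟶ X ⊗_B A` given by the unit of `A`. -/
noncomputable def relTensorUnit (X : RMod B) : X.X ⟶ relTensor i X :=
  (ρ_ X.X).inv ≫ X.X ◁ η[A] ≫ relTensorπ i X

section

variable [IsMonHom i]

/-- The morphism `M ⊗_B A ⟶ M` induced by the action of `A`. -/
noncomputable def relTensorCounit (M : RMod A) : relTensor i (M.restrict i) ⟶ M.X :=
  relTensorDesc i (M.restrict i) M.act (by
    have e := M.act_mul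
    change (M.X ◁ i ≫ M.act) ▷ A ≫ M.act = (α_ M.X B A).hom ≫ M.X ◁ (i ▷ A ≫ μ[A]) ≫ M.act
    symm
    calc _ = (α_ M.X B A).hom ≫ M.X ◁ (i ▷ A) ≫ M.X ◁ μ[A] ≫ M.act := by monoidal
      _ = _ := by rw [e]; monoidal)

theorem relTensorπ_counit (M : RMod A) :
    relTensorπ i (M.restrict i) ≫ relTensorCounit i M = M.act :=
  relTensorπ_desc ..

theorem relTensorUnit_counit (M : RMod A) :
    relTensorUnit i (M.restrict i) ≫ relTensorCounit i M = 𝟙 M.X := by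
  have e := relTensorπ_counit i M
  have h := M.act_one
  calc _ = (ρ_ M.X).inv ≫ M.X ◁ η[A] ≫ relTensorπ i (M.restrict i) ≫ relTensorCounit i M := by
        simp only [relTensorUnit, Category.assoc]; rfl
    _ = (ρ_ M.X).inv ≫ M.X ◁ η[A] ≫ M.act :=
        congrArg (fun k : M.X ⊗ A ⟶ M.X => (ρ_ M.X).inv ≫ M.X ◁ η[A] ≫ k) e
    _ = _ := by rw [h, Iso.inv_hom_id]

end

variable [∀ Z : V, PreservesColimitsOfShape WalkingParallelPair (tensorRight Z)]

theorem relTensorAct_counit [IsMonHom i] (M : RMod A) :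
    relTensorAct i (M.restrict i) ≫ relTensorCounit i M =
      relTensorCounit i M ▷ A ≫ M.act := by
  have e := M.act_mul
  rw [← cancel_epi (relTensorπ i _ ▷ A), relTensorπ_act_assoc, relTensorπ_counit,
    ← comp_whiskerRight_assoc, relTensorπ_counit]
  change (α_ M.X A A).hom ≫ M.X ◁ μ[A] ≫ M.act = M.act ▷ A ≫ M.act
  rw [e, Iso.hom_inv_id_assoc]

/-- In elements, `xb ⊗ 1 = x ⊗ i(b)1 = x ⊗ 1i(b) = (x ⊗ 1)b`. -/
theorem relTensorUnit_act (X : RMod B) :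
    X.act ≫ relTensorUnit i X =
      relTensorUnit i X ▷ B ≫ relTensor i X ◁ i ≫ relTensorAct i X := by
  simp only [relTensorUnit]
  have e1 := relTensor_condition i X
  have e2 := relTensorπ_act i X
  have h1 := MonObj.mul_one A
  have h2 := MonObj.one_mul A
  calc _ = (ρ_ (X.X ⊗ B)).inv ≫ (X.act ▷ 𝟙_ V ≫ X.X ◁ η[A]) ≫ relTensorπ i X := by monoidal
    _ = (ρ_ (X.X ⊗ B)).inv ≫ (X.X ⊗ B) ◁ η[A] ≫ (X.act ▷ A ≫ relTensorπ i X) := by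
      rw [← whisker_exchange]; monoidal
    _ = 𝟙 _ ⊗≫ X.X ◁ (B ◁ η[A] ≫ i ▷ A) ⊗≫ X.X ◁ μ[A] ⊗≫ relTensorπ i X := by
      rw [e1]; monoidal
    _ = X.X ◁ i ⊗≫ X.X ◁ (A ◁ η[A] ≫ μ[A]) ⊗≫ relTensorπ i X := by
      rw [whisker_exchange]; monoidal
    _ = X.X ◁ i ⊗≫ X.X ◁ (η[A] ▷ A ≫ μ[A]) ⊗≫ relTensorπ i X := by
      rw [h1, h2]; monoidal
    _ = 𝟙 _ ⊗≫ (X.X ⊗ 𝟙_ V) ◁ i ⊗≫ X.X ◁ η[A] ▷ A ⊗≫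
        ((α_ X.X A A).hom ≫ X.X ◁ μ[A] ≫ relTensorπ i X) := by
      monoidal
    _ = 𝟙 _ ⊗≫ ((X.X ⊗ 𝟙_ V) ◁ i ≫ (X.X ◁ η[A] ≫ relTensorπ i X) ▷ A) ⊗≫ relTensorAct i X := by
      rw [← e2]; monoidal
    _ = _ := by rw [whisker_exchange]; monoidal

/-- In elements, `(x ⊗ 1)a = x ⊗ a`: this gives the left triangle identity. -/
theorem relTensorUnit_act_eq (X : RMod B) :
    relTensorUnit i X ▷ A ≫ relTensorAct i X = relTensorπ i X := by
  have e := relTensorπ_act i X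
  have h := MonObj.one_mul A
  calc _ = (ρ_ X.X).inv ▷ A ≫ (X.X ◁ η[A]) ▷ A ≫
        (relTensorπ i X ▷ A ≫ relTensorAct i X) := by simp only [relTensorUnit]; monoidal
    _ = 𝟙 _ ⊗≫ X.X ◁ (η[A] ▷ A ≫ μ[A]) ⊗≫ relTensorπ i X := by rw [e]; monoidal
    _ = _ := by rw [h]; monoidal

variable [IsMonHom i]

/-- The unit of the adjunction between extension and restriction of scalars. -/
noncomputable def extResUnit (X : RMod B) : X ⟶ ((extScalars i).obj X).restrict i :=
  ⟨relTensorUnit i X, relTensorUnit_act i X⟩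

theorem relTensorMap_unit_counit (X : RMod B) :
    relTensorMap i (extResUnit i X) ≫ relTensorCounit i ((extScalars i).obj X) =
      𝟙 (relTensor i X) := by
  apply (cancel_epi (relTensorπ i X)).1
  refine (relTensorπ_map_assoc (extResUnit i X) _).trans ?_
  rw [relTensorπ_counit]
  exact (relTensorUnit_act_eq i X).trans (Category.comp_id _).symm

/-- Extension of scalars is left adjoint to restriction of scalars. -/
noncomputable def extResAdj : extScalars i ⊣ resScalars i :=
  Adjunction.mkOfUnitCounit
    { unit :=
        { app := extResUnit i
          naturality := fun X Y f => by
            apply RMod.hom_ext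
            change f.hom ≫ (ρ_ Y.X).inv ≫ Y.X ◁ η[A] ≫ relTensorπ i Y =
              ((ρ_ X.X).inv ≫ X.X ◁ η[A] ≫ relTensorπ i X) ≫ relTensorMap i f
            simp only [Category.assoc]
            rw [relTensorπ_map, whisker_exchange_assoc]
            simp }
      counit :=
        { app := fun M => ⟨relTensorCounit i M, relTensorAct_counit i M⟩
          naturality := fun M N f => by
            apply RMod.hom_ext
            change relTensorMap i ((resScalars i).map f) ≫ relTensorCounit i N =
              relTensorCounit i M ≫ f.hom
            apply (cancel_epi (relTensorπ i (M.restrict i))).1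
            refine (relTensorπ_map_assoc ((resScalars i).map f) _).trans ?_
            rw [← Category.assoc (relTensorπ i _), relTensorπ_counit]
            refine (congrArg (f.hom ▷ A ≫ ·) (relTensorπ_counit i N)).trans ?_
            exact f.act_hom.symm }
      left_triangle := by
        ext X
        change relTensorMap i (extResUnit i X) ≫
            𝟙 _ ≫ relTensorCounit i ((extScalars i).obj X) = 𝟙 (relTensor i X)
        exact (congrArg (_ ≫ ·) (Category.id_comp _)).trans (relTensorMap_unit_counit i X)
      right_triangle := by
        ext M
        change relTensorUnit i (M.restrict i) ≫ 𝟙 _ ≫ relTensorCounit i M = 𝟙 M.X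
        exact (congrArg (_ ≫ ·) (Category.id_comp _)).trans (relTensorUnit_counit i M) }

end Restriction

/-! ### The cofree entwined module -/

section Cofree

variable {V : Type u} [Category.{v} V] [MonoidalCategory V] {A C : V} [MonObj A] [ComonObj C]

/-- The functor forgetting the coaction. -/
def EntwinedMod.forget (ψ : Entwining A C) : EntwinedMod ψ ⥤ RMod A where
  obj M := M.toRMod
  map f := ⟨f.hom, f.act_hom⟩

variable (ψ : Entwining A C)

theorem isIso_entwinedMod_iff {M N : EntwinedMod ψ} (f : M ⟶ N) : IsIso f ↔ IsIso f.hom := by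
  constructor
  · intro _
    exact ⟨(inv f).hom, congrArg EntwinedMod.Hom.hom (IsIso.hom_inv_id f),
      congrArg EntwinedMod.Hom.hom (IsIso.inv_hom_id f)⟩
  · intro _
    refine ⟨⟨inv f.hom, ?_, ?_⟩, EntwinedMod.hom_ext _ _ (IsIso.hom_inv_id f.hom),
      EntwinedMod.hom_ext _ _ (IsIso.inv_hom_id f.hom)⟩
    · rw [IsIso.comp_inv_eq, Category.assoc, f.act_hom, ← comp_whiskerRight_assoc,
        IsIso.inv_hom_id, id_whiskerRight, Category.id_comp]
    · rw [IsIso.eq_inv_comp, ← Category.assoc, ← f.coact_hom, Category.assoc,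
        ← comp_whiskerRight, IsIso.hom_inv_id, id_whiskerRight, Category.comp_id]

/-- The entwined module `M ⊗ C` cofreely generated by a right module `M`. -/
def cofreeObj (M : RMod A) : EntwinedMod ψ where
  X := M.X ⊗ C
  -- Each entwining axiom has one role: `one_hom` and `mul_hom` make this an action, `hom_comul`
  -- gives the compatibility, and `hom_counit` makes the counit of `forgetCofreeAdj` linear.
  act := (α_ M.X C A).hom ≫ M.X ◁ ψ.hom ≫ (α_ M.X A C).inv ≫ M.act ▷ C
  act_one := by
    have e := ψ.one_hom
    have h := M.act_one
    calc _ = 𝟙 _ ⊗≫ M.X ◁ (C ◁ η[A] ≫ ψ.hom) ⊗≫ M.act ▷ C := by monoidal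
      _ = 𝟙 _ ⊗≫ (M.X ◁ η[A] ≫ M.act) ▷ C := by rw [e]; monoidal
      _ = _ := by rw [h]; monoidal
  act_mul := by
    have e := ψ.mul_hom
    have h := M.act_mul
    calc _ = 𝟙 _ ⊗≫ M.X ◁ (C ◁ μ[A] ≫ ψ.hom) ⊗≫ M.act ▷ C := by monoidal
      _ = 𝟙 _ ⊗≫ M.X ◁ ψ.hom ▷ A ⊗≫ M.X ◁ A ◁ ψ.hom ⊗≫ (M.X ◁ μ[A] ≫ M.act) ▷ C := by
        rw [e]; monoidal
      _ = 𝟙 _ ⊗≫ M.X ◁ ψ.hom ▷ A ⊗≫ ((M.X ⊗ A) ◁ ψ.hom ≫ M.act ▷ (A ⊗ C)) ⊗≫ M.act ▷ C := by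
        rw [h]; monoidal
      _ = _ := by rw [whisker_exchange]; monoidal
  coact := M.X ◁ Δ[C] ≫ (α_ M.X C C).inv
  coact_counit := by
    have e := ComonObj.comul_counit C
    calc _ = M.X ◁ (Δ[C] ≫ C ◁ ε[C]) ⊗≫ 𝟙 _ := by monoidal
      _ = _ := by rw [e]; monoidal
  coact_comul := by
    have e := ComonObj.comul_assoc C
    calc _ = M.X ◁ (Δ[C] ≫ C ◁ Δ[C]) ⊗≫ 𝟙 _ := by monoidal
      _ = _ := by rw [e]; monoidal
  compat := by
    have e := ψ.hom_comul
    calc _ = 𝟙 _ ⊗≫ M.X ◁ ψ.hom ⊗≫ (M.act ▷ C ≫ M.X ◁ Δ[C]) ⊗≫ 𝟙 _ := by monoidal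
      _ = 𝟙 _ ⊗≫ M.X ◁ (ψ.hom ≫ A ◁ Δ[C]) ⊗≫ M.act ▷ (C ⊗ C) ⊗≫ 𝟙 _ := by
        rw [← whisker_exchange]; monoidal
      _ = _ := by rw [e]; monoidal

/-- The cofree functor `M ↦ M ⊗ C`. -/
def cofree : RMod A ⥤ EntwinedMod ψ where
  obj M := cofreeObj ψ M
  map {M N} f :=
    { hom := f.hom ▷ C
      act_hom := by
        have e := f.act_hom
        change ((α_ M.X C A).hom ≫ M.X ◁ ψ.hom ≫ (α_ M.X A C).inv ≫ M.act ▷ C) ≫ f.hom ▷ C =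
          (f.hom ▷ C) ▷ A ≫ (α_ N.X C A).hom ≫ N.X ◁ ψ.hom ≫ (α_ N.X A C).inv ≫ N.act ▷ C
        calc _ = 𝟙 _ ⊗≫ M.X ◁ ψ.hom ⊗≫ (M.act ≫ f.hom) ▷ C := by monoidal
          _ = 𝟙 _ ⊗≫ (M.X ◁ ψ.hom ≫ f.hom ▷ (A ⊗ C)) ⊗≫ N.act ▷ C := by rw [e]; monoidal
          _ = _ := by rw [whisker_exchange]; monoidal
      coact_hom := by
        change (M.X ◁ Δ[C] ≫ (α_ M.X C C).inv) ≫ f.hom ▷ C ▷ C =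
          f.hom ▷ C ≫ N.X ◁ Δ[C] ≫ (α_ N.X C C).inv
        rw [← whisker_exchange_assoc]; monoidal }
  map_id M := EntwinedMod.hom_ext _ _ (id_whiskerRight ..)
  map_comp f g := EntwinedMod.hom_ext _ _ (comp_whiskerRight ..)

/-- Forgetting the coaction is left adjoint to the cofree functor. -/
def forgetCofreeAdj : EntwinedMod.forget ψ ⊣ cofree ψ :=
  Adjunction.mkOfUnitCounit
    { unit :=
        -- The unit is the coaction; entwined compatibility is precisely its `A`-linearity into `N ⊗
        -- C`.
        { app := fun N => ⟨N.coact, N.compat, by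
            change N.coact ≫ N.coact ▷ C = N.coact ≫ N.X ◁ Δ[C] ≫ (α_ N.X C C).inv
            rw [reassoc_of% N.coact_comul, Iso.hom_inv_id, Category.comp_id]⟩
          naturality := fun N N' f => EntwinedMod.hom_ext _ _ f.coact_hom.symm }
      counit :=
        { app := fun M => ⟨M.X ◁ ε[C] ≫ (ρ_ M.X).hom, by
            have e := ψ.hom_counit
            change ((α_ M.X C A).hom ≫ M.X ◁ ψ.hom ≫ (α_ M.X A C).inv ≫ M.act ▷ C) ≫
              M.X ◁ ε[C] ≫ (ρ_ M.X).hom = (M.X ◁ ε[C] ≫ (ρ_ M.X).hom) ▷ A ≫ M.act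
            calc _ = 𝟙 _ ⊗≫ M.X ◁ ψ.hom ⊗≫ (M.act ▷ C ≫ M.X ◁ ε[C]) ⊗≫ 𝟙 _ := by monoidal
              _ = 𝟙 _ ⊗≫ M.X ◁ (ψ.hom ≫ A ◁ ε[C]) ⊗≫ M.act ⊗≫ 𝟙 _ := by
                rw [← whisker_exchange]; monoidal
              _ = _ := by rw [e]; monoidal⟩
          naturality := fun M N f => by
            apply RMod.hom_ext
            change f.hom ▷ C ≫ N.X ◁ ε[C] ≫ (ρ_ N.X).hom =
              (M.X ◁ ε[C] ≫ (ρ_ M.X).hom) ≫ f.hom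
            rw [← whisker_exchange_assoc]; monoidal }
      left_triangle := by
        ext N
        change N.coact ≫ 𝟙 _ ≫ N.X ◁ ε[C] ≫ (ρ_ N.X).hom = 𝟙 N.X
        rw [Category.id_comp, reassoc_of% N.coact_counit, Iso.inv_hom_id]
      right_triangle := by
        ext M
        have e := ComonObj.counit_comul C
        change (M.X ◁ Δ[C] ≫ (α_ M.X C C).inv) ≫ 𝟙 _ ≫ (M.X ◁ ε[C] ≫ (ρ_ M.X).hom) ▷ C = 𝟙 _
        calc _ = M.X ◁ (Δ[C] ≫ ε[C] ▷ C) ⊗≫ 𝟙 _ := by monoidal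
          _ = _ := by rw [e]; monoidal }

/-- Entwined modules are the coalgebras over the comonad `- ⊗ C` on right `A`-modules. -/
instance : (Comonad.comparison (forgetCofreeAdj ψ)).IsEquivalence where
  faithful := ⟨fun {N N'} f g h => EntwinedMod.hom_ext _ _
    (congrArg (fun k => RMod.Hom.hom (Comonad.Coalgebra.Hom.f k)) h)⟩
  full := ⟨fun {N N'} f => ⟨⟨f.f.hom, f.f.act_hom, congrArg RMod.Hom.hom f.h⟩, rfl⟩⟩
  essSurj := ⟨fun Q => by
    let q : Q.A.X ⟶ Q.A.X ⊗ C := Q.a.hom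
    have h1 : q ≫ Q.A.X ◁ ε[C] ≫ (ρ_ Q.A.X).hom = 𝟙 _ := congrArg RMod.Hom.hom Q.counit
    have h2 : q ≫ Q.A.X ◁ Δ[C] ≫ (α_ Q.A.X C C).inv = q ≫ q ▷ C :=
      congrArg RMod.Hom.hom Q.coassoc
    let N : EntwinedMod ψ :=
      { toRMod := Q.A
        coact := q
        coact_counit := by
          rw [← Category.comp_id (q ≫ _), ← Iso.hom_inv_id, Category.assoc, reassoc_of% h1]
        coact_comul := by rw [← reassoc_of% h2]; simp
        compat := Q.a.act_hom }
    refine ⟨N, ⟨Comonad.Coalgebra.isoMk (Iso.refl _) ?_⟩⟩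
    apply RMod.hom_ext
    change q ≫ 𝟙 Q.A.X ▷ C = 𝟙 _ ≫ q
    simp⟩

end Cofree

/-! ### The canonical morphism of a module -/

section Canonical

variable {V : Type u} [Category.{v} V] [MonoidalCategory V]

/-- If `P` and `Q` are quotients of `A ⊗ A` and `M ⊗ A`, related by the action of `A` on `M`, and
the canonical morphism `P ⟶ A ⊗ H` is invertible, then so is `Q ⟶ M ⊗ H`. -/
theorem isIso_of_isIso_regular {A H P Q : V} [MonObj A] (M : RMod A) (a : A ⟶ A ⊗ H)
    (p : A ⊗ A ⟶ P) (c : P ⟶ A ⊗ H) (l : A ⊗ P ⟶ P) (π : M.X ⊗ A ⟶ Q) (d : Q ⟶ M.X ⊗ H)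
    (q : M.X ⊗ P ⟶ Q) [Epi (A ◁ p)] [Epi (M.X ◁ p)] [Epi (M.X ◁ A ◁ p)] [Epi π]
    (hc : p ≫ c = A ◁ a ≫ (α_ A A H).inv ≫ μ[A] ▷ H)
    (hd : π ≫ d = M.X ◁ a ≫ (α_ M.X A H).inv ≫ M.act ▷ H)
    (hl : A ◁ p ≫ l = (α_ A A A).inv ≫ μ[A] ▷ A ≫ p)
    (hq : M.X ◁ p ≫ q = (α_ M.X A A).inv ≫ M.act ▷ A ≫ π) [IsIso c] : IsIso d := by
  have h1 := M.act_one
  have h2 := M.act_mul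
  have h3 := MonObj.mul_one A
  have h4 := MonObj.one_mul A
  have h5 := MonObj.mul_assoc_flip A
  -- In elements, `q(m ⊗ (a ⊗ b)) = ma ⊗ b`, and `l` is the left action of `A` on `P`. The facts
  -- prepared here are: `c` and `c⁻¹` are left `A`-linear (`lc`, `lc'`), `q` is balanced over `A`
  -- (`lq`), and `c⁻¹(a₀ ⊗ a₁) = 1 ⊗ a` (`ca`).
  have qd : q ≫ d = M.X ◁ c ≫ (α_ M.X A H).inv ≫ M.act ▷ H := by
    rw [← cancel_epi (M.X ◁ p), reassoc_of% hq, hd, ← whiskerLeft_comp_assoc, hc]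
    calc _ = 𝟙 _ ⊗≫ (M.act ▷ A ≫ M.X ◁ a) ⊗≫ M.act ▷ H := by monoidal
      _ = 𝟙 _ ⊗≫ M.X ◁ A ◁ a ⊗≫ ((α_ M.X A A).inv ≫ M.act ▷ A ≫ M.act) ▷ H := by
        rw [← whisker_exchange]; monoidal
      _ = _ := by rw [← h2]; monoidal
  have lc : l ≫ c = A ◁ c ≫ (α_ A A H).inv ≫ μ[A] ▷ H := by
    rw [← cancel_epi (A ◁ p), reassoc_of% hl, hc, ← whiskerLeft_comp_assoc, hc]
    calc _ = 𝟙 _ ⊗≫ (μ[A] ▷ A ≫ A ◁ a) ⊗≫ μ[A] ▷ H := by monoidal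
      _ = 𝟙 _ ⊗≫ A ◁ A ◁ a ⊗≫ ((α_ A A A).inv ≫ μ[A] ▷ A ≫ μ[A]) ▷ H := by
        rw [← whisker_exchange]; monoidal
      _ = _ := by rw [← h5]; monoidal
  have lc' : A ◁ inv c ≫ l = (α_ A A H).inv ≫ μ[A] ▷ H ≫ inv c := by
    have e : A ◁ inv c ≫ A ◁ c = 𝟙 _ := by
      rw [← MonoidalCategory.whiskerLeft_comp, IsIso.inv_hom_id, MonoidalCategory.whiskerLeft_id]
    rw [← cancel_mono c]
    simp only [Category.assoc]
    rw [lc, reassoc_of% e, IsIso.inv_hom_id, Category.comp_id]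
  have lq : (α_ M.X A P).inv ≫ M.act ▷ P ≫ q = M.X ◁ l ≫ q := by
    rw [← cancel_epi (M.X ◁ A ◁ p)]
    calc _ = 𝟙 _ ⊗≫ ((M.X ⊗ A) ◁ p ≫ M.act ▷ P) ≫ q := by monoidal
      _ = 𝟙 _ ⊗≫ M.act ▷ (A ⊗ A) ≫ (M.X ◁ p ≫ q) := by rw [whisker_exchange]; monoidal
      _ = 𝟙 _ ⊗≫ ((α_ M.X A A).inv ≫ M.act ▷ A ≫ M.act) ▷ A ≫ π := by rw [hq]; monoidal
      _ = 𝟙 _ ⊗≫ M.X ◁ μ[A] ▷ A ⊗≫ ((α_ M.X A A).inv ≫ M.act ▷ A ≫ π) := by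
        rw [← h2]; monoidal
      _ = M.X ◁ ((α_ A A A).inv ≫ μ[A] ▷ A ≫ p) ≫ q := by rw [← hq]; monoidal
      _ = _ := by rw [← hl]; monoidal
  have ca : a ≫ inv c = (λ_ A).inv ≫ η[A] ▷ A ≫ p := by
    rw [IsIso.comp_inv_eq]
    simp only [Category.assoc]
    rw [hc]
    symm
    calc _ = (λ_ A).inv ≫ (η[A] ▷ A ≫ A ◁ a) ≫ (α_ A A H).inv ≫ μ[A] ▷ H := by monoidal
      _ = (λ_ A).inv ≫ 𝟙_ V ◁ a ⊗≫ (η[A] ▷ A ≫ μ[A]) ▷ H := by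
        rw [← whisker_exchange]; monoidal
      _ = _ := by rw [h4]; monoidal
  -- The inverse is `m ⊗ h ↦ q(m ⊗ c⁻¹(1 ⊗ h))`. On `m ⊗ a` the first composite is `q(ma₀ ⊗ c⁻¹(1 ⊗
  -- a₁)) = q(m ⊗ c⁻¹(a₀ ⊗ a₁)) = m ⊗ a`; the second follows from `qd`.
  refine ⟨M.X ◁ ((λ_ H).inv ≫ η[A] ▷ H) ≫ M.X ◁ inv c ≫ q, ?_, ?_⟩
  · rw [← cancel_epi π, reassoc_of% hd]
    calc _ = M.X ◁ a ⊗≫ (M.act ▷ H ≫ M.X ◁ ((λ_ H).inv ≫ η[A] ▷ H ≫ inv c)) ≫ q := by monoidal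
      _ = M.X ◁ a ⊗≫ M.X ◁ A ◁ ((λ_ H).inv ≫ η[A] ▷ H ≫ inv c) ⊗≫
          ((α_ M.X A P).inv ≫ M.act ▷ P ≫ q) := by rw [← whisker_exchange]; monoidal
      _ = M.X ◁ a ⊗≫ M.X ◁ A ◁ ((λ_ H).inv ≫ η[A] ▷ H) ⊗≫ M.X ◁ (A ◁ inv c ≫ l) ≫ q := by
        rw [lq]; monoidal
      _ = M.X ◁ a ⊗≫ M.X ◁ (A ◁ η[A] ≫ μ[A]) ▷ H ≫ M.X ◁ inv c ≫ q := by
        rw [lc']; monoidal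
      _ = M.X ◁ (a ≫ inv c) ≫ q := by rw [h3]; monoidal
      _ = M.X ◁ ((λ_ A).inv ≫ η[A] ▷ A) ≫ (M.X ◁ p ≫ q) := by rw [ca]; monoidal
      _ = 𝟙 _ ⊗≫ (M.X ◁ η[A] ≫ M.act) ▷ A ≫ π := by rw [hq]; monoidal
      _ = _ := by rw [h1]; monoidal
  · have e : M.X ◁ inv c ≫ M.X ◁ c = 𝟙 _ := by
      rw [← MonoidalCategory.whiskerLeft_comp, IsIso.inv_hom_id, MonoidalCategory.whiskerLeft_id]
    simp only [Category.assoc]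
    rw [qd, reassoc_of% e]
    calc _ = 𝟙 _ ⊗≫ (M.X ◁ η[A] ≫ M.act) ▷ H := by monoidal
      _ = _ := by rw [h1]; monoidal

variable [HasCoequalizers V]

theorem relTensorπ_coact_counit [BraidedCategory V] [HasEqualizers V] (H A : V) [BimonObj H]
    [MonObj A] [ComodAlg H A] (M : RMod A) :
    relTensorπ (coinvIncl H A) (M.restrict (coinvIncl H A)) ≫
        (relTensorCoact H A (M.restrict _) ≫ relTensorCounit (coinvIncl H A) M ▷ H) =
      M.X ◁ coact H A ≫ (α_ M.X A H).inv ≫ M.act ▷ H := by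
  rw [relTensorπ_coact_assoc, ← comp_whiskerRight, relTensorπ_counit]
  rfl

variable [∀ Z : V, PreservesColimitsOfShape WalkingParallelPair (tensorLeft Z)]

theorem epi_whiskerLeft_relTensorπ {B A : V} [MonObj B] [MonObj A] (i : B ⟶ A) (X : RMod B)
    (Z : V) : Epi (Z ◁ relTensorπ i X) :=
  (inferInstance : Epi ((tensorLeft Z).map
    (coequalizer.π (X.act ▷ A) ((α_ X.X B A).hom ≫ X.X ◁ (i ▷ A ≫ μ[A])))))

/-- The morphism `M ⊗ (A ⊗_B A) ⟶ M ⊗_B A` induced by the action of `A` on `M` exists. -/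
theorem exists_act_relTensor {B A : V} [MonObj B] [MonObj A] (i : B ⟶ A) [IsMonHom i]
    (M : RMod A) : ∃ q : M.X ⊗ relTensor i (RMod.ofHom i) ⟶ relTensor i (M.restrict i),
      M.X ◁ relTensorπ i (RMod.ofHom i) ≫ q =
        (α_ M.X A A).inv ≫ M.act ▷ A ≫ relTensorπ i (M.restrict i) := by
  -- In elements, `m(a i(b)) ⊗ a' = (ma)i(b) ⊗ a' = ma ⊗ i(b)a'`, so the morphism descends because
  -- `M ⊗ -` preserves the coequalizer.
  have w : M.X ◁ ((A ◁ i ≫ μ[A]) ▷ A) ≫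
        ((α_ M.X A A).inv ≫ M.act ▷ A ≫ relTensorπ i (M.restrict i)) =
      M.X ◁ ((α_ A B A).hom ≫ A ◁ (i ▷ A ≫ μ[A])) ≫
        ((α_ M.X A A).inv ≫ M.act ▷ A ≫ relTensorπ i (M.restrict i)) := by
    have h := M.act_mul
    have e : (M.X ◁ i ≫ M.act) ▷ A ≫ relTensorπ i (M.restrict i) =
        (α_ M.X B A).hom ≫ M.X ◁ (i ▷ A ≫ μ[A]) ≫ relTensorπ i (M.restrict i) :=
      relTensor_condition i (M.restrict i)
    generalize (relTensorπ i (M.restrict i) : M.X ⊗ A ⟶ _) = π at e ⊢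
    calc _ = 𝟙 _ ⊗≫ M.X ◁ A ◁ i ▷ A ⊗≫ (M.X ◁ μ[A] ≫ M.act) ▷ A ≫ π := by monoidal
      _ = 𝟙 _ ⊗≫ ((M.X ⊗ A) ◁ i ≫ M.act ▷ A) ▷ A ⊗≫ M.act ▷ A ≫ π := by rw [h]; monoidal
      _ = 𝟙 _ ⊗≫ M.act ▷ B ▷ A ⊗≫ ((M.X ◁ i ≫ M.act) ▷ A ≫ π) := by
        rw [whisker_exchange]; monoidal
      _ = 𝟙 _ ⊗≫ (M.act ▷ (B ⊗ A) ≫ M.X ◁ (i ▷ A ≫ μ[A])) ≫ π := by rw [e]; monoidal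
      _ = _ := by rw [← whisker_exchange]; monoidal
  exact ⟨(PreservesCoequalizer.iso (tensorLeft M.X) ((A ◁ i ≫ μ[A]) ▷ A)
    ((α_ A B A).hom ≫ A ◁ (i ▷ A ≫ μ[A]))).inv ≫ coequalizer.desc _ w,
    map_π_preserves_coequalizer_inv_desc (tensorLeft M.X) _ _ _ w⟩

variable [BraidedCategory V] [HasEqualizers V]
variable (H A : V) [BimonObj H] [MonObj A] [ComodAlg H A]

/-- The regular module has `can` as its canonical morphism, and `isIso_of_isIso_regular` propagates
invertibility from it to every `M`. -/
theorem isIso_coact_counit_iff :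
    (∀ M : RMod A, IsIso (relTensorCoact H A (M.restrict (coinvIncl H A)) ≫
      relTensorCounit (coinvIncl H A) M ▷ H)) ↔ IsIso (can H A) := by
  have hc : relTensorπ (coinvIncl H A) (RMod.ofHom (coinvIncl H A)) ≫ can H A =
      A ◁ coact H A ≫ (α_ A A H).inv ≫ μ[A] ▷ H := relTensorπ_desc ..
  constructor
  · intro h
    have e : relTensorCoact H A ((RMod.regular A).restrict (coinvIncl H A)) ≫
        relTensorCounit (coinvIncl H A) (RMod.regular A) ▷ H = can H A := by
      apply (cancel_epi (relTensorπ (coinvIncl H A) (RMod.ofHom (coinvIncl H A)))).1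
      exact (relTensorπ_coact_counit H A (RMod.regular A)).trans hc.symm
    exact e ▸ h (RMod.regular A)
  · intro _ M
    obtain ⟨q, hq⟩ := exists_act_relTensor (coinvIncl H A) M
    obtain ⟨l, hl⟩ := exists_act_relTensor (coinvIncl H A) (RMod.regular A)
    let p : A ⊗ A ⟶ _ := relTensorπ (coinvIncl H A) (RMod.ofHom (coinvIncl H A))
    have : Epi (A ◁ p) := epi_whiskerLeft_relTensorπ _ _ _
    have : Epi (M.X ◁ p) := epi_whiskerLeft_relTensorπ _ _ _
    have : Epi (M.X ◁ A ◁ p) :=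
      (inferInstance : Epi ((tensorLeft A ⋙ tensorLeft M.X).map
        (coequalizer.π ((A ◁ coinvIncl H A ≫ μ[A]) ▷ A)
          ((α_ A (coinv H A) A).hom ≫ A ◁ (coinvIncl H A ▷ A ≫ μ[A])))))
    let π : M.X ⊗ A ⟶ _ := relTensorπ (coinvIncl H A) (M.restrict (coinvIncl H A))
    have : Epi π :=
      inferInstanceAs (Epi (relTensorπ (coinvIncl H A) (M.restrict (coinvIncl H A))))
    exact isIso_of_isIso_regular M (coact H A) p (can H A) l π _ q hc
      (relTensorπ_coact_counit H A M) hl hq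

end Canonical

end BraidedGalois

/-! ### The Galois criterion -/

theorem theorem5p12 {V : Type u} [Category.{v} V] [MonoidalCategory V] [BraidedCategory V]
    [HasEqualizers V] [HasCoequalizers V]
    [∀ Z : V, PreservesColimitsOfShape WalkingParallelPair (tensorLeft Z)]
    [∀ Z : V, PreservesColimitsOfShape WalkingParallelPair (tensorRight Z)]
    (H A : V) [BimonObj H] [MonObj A] [BraidedGalois.ComodAlg H A] :
    (BraidedGalois.galoisFunctor H A).IsEquivalence ↔
      Nonempty (ComonadicLeftAdjoint
        (BraidedGalois.extScalars (BraidedGalois.coinvIncl H A))) ∧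
      IsIso (BraidedGalois.can H A) := by
  -- The Galois functor followed by the forgetful functor is extension of scalars by definition.
  let adj : BraidedGalois.galoisFunctor H A ⋙
      BraidedGalois.EntwinedMod.forget (BraidedGalois.entwining H A) ⊣
        BraidedGalois.resScalars (BraidedGalois.coinvIncl H A) :=
    BraidedGalois.extResAdj (BraidedGalois.coinvIncl H A)
  rw [BraidedGalois.isEquivalence_iff_comonadic adj
      (BraidedGalois.forgetCofreeAdj (BraidedGalois.entwining H A)),
    ← BraidedGalois.isIso_coact_counit_iff H A]
  -- The morphism of `V` underlying `t` unfolds to the coaction on `M ⊗_{A^H} A` followed by the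
  -- counit tensored with `H`.
  exact and_congr Iff.rfl (forall_congr' fun M => BraidedGalois.isIso_entwinedMod_iff _ _)
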